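/- Let $\mathfrak g_o$ be a finite-dimensional real semisimple Lie algebra with Cartan involution $\theta$ and Cartan decomposition $\mathfrak g_o=\mathfrak k_o\oplus\mathfrak p_o$. Let $\mathfrak g,\mathfrak k,\mathfrak p$ be the complexifications of $\mathfrak g_o,\mathfrak k_o,\mathfrak p_o$; extend $\theta$ complex-linearly to $\mathfrak g$, and let $\sigma$ be the conjugation of $\mathfrak g$ with respect to $\mathfrak g_o$. Let $(h,e,f)$ be a KS-triple, that is, $[h,e]=2e$, $[h,f]=-2f$, $[e,f]=h\neq 0$, with $e,f\in\mathfrak p$, $f=\sigma(e)$ and $h\in i\mathfrak k_o$. For $j\in\mathbb Z$ put $\mathfrak g^{(j)}=\{x\in\mathfrak g:[h,x]=jx\}$. Let $\mathfrak h=\mathfrak t\oplus\mathfrak a$ be a ($\theta$-stable, maximally compact) Cartan subalgebra of $\mathfrak g$, where $\mathfrak t$ is a maximal abelian subspace of $\mathfrak k$, $h\in\mathfrak t$, and $\mathfrak a$ is maximal among the abelian subspaces of $\mathfrak p$ that commute with $\mathfrak t$. Let $\Delta$ be the root system of $(\mathfrak g,\mathfrak h)$, with root spaces $\mathfrak g_\alpha$,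 on which $\theta$ acts by $(\theta\alpha)(x)=\alpha(\theta x)$. Let $\Psi=\{\alpha_1,\dots,\alpha_n\}\subset\Delta$ be a $\theta$-stable set of simple roots with $\alpha_i(h)\ge 0$ for all $i$, and let $\Delta^+$ be the corresponding set of positive roots. For $\alpha=\sum_i n_i\alpha_i\in\Delta^+$ let $\omega_\alpha=\alpha(h)$ be its weight and let $$m_\alpha=\sum_{i:\ \mathfrak g_{\alpha_i}\subset\mathfrak p} n_i$$ be its non-compact length. For an integer $j\ge0$ define $$\begin{aligned} M_{\mathfrak k}^{(j)}&=\{\alpha\in\Delta^+:\ \omega_\alpha=j,\ \theta\alpha=\alpha,\ m_\alpha\text{ even},\ \alpha\text{ is not of the form }\gamma+\theta\gamma\text{ with }\gamma\in\Delta^+\},\\ M_{\mathfrak p}^{(j)}&=\{\alpha\in\Delta^+:\ \omega_\alpha=j,\ \theta\alpha=\alpha,\ m_\alpha\text{ odd}\}\cup\{\gamma+\theta\gamma\in\Delta^+:\ \gamma\in\Delta^+,\ 2\omega_\gamma=j\},\\ C^{(j)}&=\{\{\alpha,\theta\alpha\}:\ \alpha\in\Delta^+,\ \theta\alpha\ne\alpha,\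 \omega_\alpha=j\}. \end{aligned}$$ Choose nonzero vectors $X_\alpha\in\mathfrak g_\alpha$ for $\alpha\in\Delta$, and in each pair $\{\alpha,\theta\alpha\}$ choose one of its elements as the representative $\alpha$. Then, for any such choices, the following internal direct sum decompositions hold: $$\begin{aligned} \mathfrak g^{(0)}\cap\mathfrak k&=\mathfrak t\oplus\bigoplus_{\alpha\in\pm M_{\mathfrak k}^{(0)}}\mathfrak g_\alpha\oplus\bigoplus_{\{\alpha,\theta\alpha\}\in\pm C^{(0)}}\mathbb C\,(X_\alpha+\theta X_\alpha),\\ \mathfrak g^{(j)}\cap\mathfrak k&=\bigoplus_{\alpha\in M_{\mathfrak k}^{(j)}}\mathfrak g_\alpha\oplus\bigoplus_{\{\alpha,\theta\alpha\}\in C^{(j)}}\mathbb C\,(X_\alpha+\theta X_\alpha)\qquad(j>0),\\ \mathfrak g^{(0)}\cap\mathfrak p&=\mathfrak a\oplus\bigoplus_{\alpha\in\pm M_{\mathfrak p}^{(0)}}\mathfrak g_\alpha\oplus\bigoplus_{\{\alpha,\theta\alpha\}\in\pm C^{(0)}}\mathbb C\,(X_\alpha-\theta X_\alpha),\\ \mathfrak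 g^{(j)}\cap\mathfrak p&=\bigoplus_{\alpha\in M_{\mathfrak p}^{(j)}}\mathfrak g_\alpha\oplus\bigoplus_{\{\alpha,\theta\alpha\}\in C^{(j)}}\mathbb C\,(X_\alpha-\theta X_\alpha)\qquad(j>0). \end{aligned}$$ Here $\pm M=M\cup\{-\alpha:\alpha\in M\}$ and $\pm C=C\cup\{\{-\alpha,-\theta\alpha\}:\{\alpha,\theta\alpha\}\in C\}$. -/

import Mathlib

open scoped TensorProduct ComplexOrder
open LieAlgebra LieAlgebra.IsKilling

noncomputable section

namespace SymmetricPair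

/-- A Cartan involution of a real Lie algebra: an involutive automorphism `θ` such that
`-B(x, θ y)` is positive definite, `B` being the Killing form. -/
structure IsCartanInvolution {g₀ : Type*} [LieRing g₀] [LieAlgebra ℝ g₀]
    (θ : g₀ →ₗ⁅ℝ⁆ g₀) : Prop where
  involutive : ∀ x, θ (θ x) = x
  posDef : ∀ x, x ≠ 0 → 0 < -(killingForm ℝ g₀ x (θ x))

/-- The subalgebra `k₀` of fixed points of `θ` (as a real subspace). -/
def k₀ {g₀ : Type*} [LieRing g₀] [LieAlgebra ℝ g₀] (θ : g₀ →ₗ⁅ℝ⁆ g₀) : Submodule ℝ g₀ :=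
  Module.End.eigenspace (θ : g₀ →ₗ[ℝ] g₀) 1

/-- The `(-1)`-eigenspace `p₀` of `θ`. -/
def p₀ {g₀ : Type*} [LieRing g₀] [LieAlgebra ℝ g₀] (θ : g₀ →ₗ⁅ℝ⁆ g₀) : Submodule ℝ g₀ :=
  Module.End.eigenspace (θ : g₀ →ₗ[ℝ] g₀) (-1)

/-- The complexification `k` of `k₀`, inside `g = ℂ ⊗ g₀`. -/
def k {g₀ : Type*} [LieRing g₀] [LieAlgebra ℝ g₀] (θ : g₀ →ₗ⁅ℝ⁆ g₀) :
    Submodule ℂ (ℂ ⊗[ℝ] g₀) :=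
  (k₀ θ).baseChange ℂ

/-- The complexification `p` of `p₀`, inside `g = ℂ ⊗ g₀`. -/
def p {g₀ : Type*} [LieRing g₀] [LieAlgebra ℝ g₀] (θ : g₀ →ₗ⁅ℝ⁆ g₀) :
    Submodule ℂ (ℂ ⊗[ℝ] g₀) :=
  (p₀ θ).baseChange ℂ

/-- The complex linear extension of `θ` to `g = ℂ ⊗ g₀`. -/
def thetaC {g₀ : Type*} [LieRing g₀] [LieAlgebra ℝ g₀] (θ : g₀ →ₗ⁅ℝ⁆ g₀) :
    (ℂ ⊗[ℝ] g₀) →ₗ[ℂ] (ℂ ⊗[ℝ] g₀) :=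
  (θ : g₀ →ₗ[ℝ] g₀).baseChange ℂ

/-- The conjugation `σ` of `g = ℂ ⊗ g₀` with respect to the real form `g₀`. -/
def sigma (g₀ : Type*) [LieRing g₀] [LieAlgebra ℝ g₀] :
    (ℂ ⊗[ℝ] g₀) →ₗ[ℝ] (ℂ ⊗[ℝ] g₀) :=
  TensorProduct.map Complex.conjAe.toLinearMap LinearMap.id

/-- A KS-triple: an `sl₂`-triple `(h, e, f)` of `g` which is normal (`h ∈ k` and `e, f ∈ p`) and
satisfies `f = σ e` and `h ∈ i k₀`. -/
structure IsKSTriple {g₀ : Type*} [LieRing g₀] [LieAlgebra ℝ g₀] (θ : g₀ →ₗ⁅ℝ⁆ g₀)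
    (h e f : ℂ ⊗[ℝ] g₀) : Prop where
  isSl2Triple : IsSl2Triple h e f
  h_mem_k : h ∈ k θ
  e_mem_p : e ∈ p θ
  f_mem_p : f ∈ p θ
  f_eq : f = sigma g₀ e
  h_mem_ik₀ : ∃ x ∈ k₀ θ, h = Complex.I ⊗ₜ[ℝ] x

/-- A subspace on which the bracket vanishes. -/
def IsAbelianSubspace {g : Type*} [LieRing g] [LieAlgebra ℂ g] (s : Submodule ℂ g) : Prop :=
  ∀ x ∈ s, ∀ y ∈ s, ⁅x, y⁆ = 0

/-- `H = t ⊕ a` with `t` a maximal abelian subspace of `k` that contains `h`, and `a` a maximal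
abelian subspace among those subspaces of `p` that commute with `t`. (When `H` is a Cartan
subalgebra, this says that `H` is a `θ`-stable maximally compact one.) -/
structure IsMaximallyCompact {g₀ : Type*} [LieRing g₀] [LieAlgebra ℝ g₀] (θ : g₀ →ₗ⁅ℝ⁆ g₀)
    (h : ℂ ⊗[ℝ] g₀) (H : LieSubalgebra ℂ (ℂ ⊗[ℝ] g₀)) (t a : Submodule ℂ (ℂ ⊗[ℝ] g₀)) :
    Prop where
  h_mem : h ∈ t
  t_maximal : Maximal (fun s : Submodule ℂ (ℂ ⊗[ℝ] g₀) => s ≤ k θ ∧ IsAbelianSubspace s) t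
  a_maximal : Maximal (fun s : Submodule ℂ (ℂ ⊗[ℝ] g₀) => s ≤ p θ ∧ IsAbelianSubspace s ∧
    ∀ x ∈ s, ∀ y ∈ t, ⁅x, y⁆ = 0) a
  disjoint : Disjoint t a
  sup_eq : t ⊔ a = H.toSubmodule

section basic

variable {g₀ : Type*} [LieRing g₀] [LieAlgebra ℝ g₀] {θ : g₀ →ₗ⁅ℝ⁆ g₀}

lemma thetaC_of_mem_k {x : ℂ ⊗[ℝ] g₀} (hx : x ∈ k θ) : thetaC θ x = x := by
  rw [k, Submodule.baseChange_eq_span] at hx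
  induction hx using Submodule.span_induction with
  | mem x hx =>
    obtain ⟨y, hy, rfl⟩ := hx
    have : θ y = y := by simpa [k₀, Module.End.mem_eigenspace_iff] using hy
    simp [thetaC, this]
  | zero => simp
  | add x y _ _ hx hy => rw [map_add, hx, hy]
  | smul c x _ hx => rw [map_smul, hx]

lemma thetaC_of_mem_p {x : ℂ ⊗[ℝ] g₀} (hx : x ∈ p θ) : thetaC θ x = -x := by
  rw [p, Submodule.baseChange_eq_span] at hx
  induction hx using Submodule.span_induction with
  | mem x hx =>
    obtain ⟨y, hy, rfl⟩ := hx
    have : θ y = -y := by simpa [p₀, Module.End.mem_eigenspace_iff] using hy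
    simp [thetaC, this, TensorProduct.tmul_neg]
  | zero => simp
  | add x y _ _ hx hy => rw [map_add, hx, hy, neg_add]
  | smul c x _ hx => rw [map_smul, hx, smul_neg]

lemma thetaC_lie (x y : ℂ ⊗[ℝ] g₀) : thetaC θ ⁅x, y⁆ = ⁅thetaC θ x, thetaC θ y⁆ := by
  exact LieHom.map_lie (LieAlgebra.ExtendScalars.map (AlgHom.id ℝ ℂ) θ) x y

lemma thetaC_thetaC (hθ : IsCartanInvolution θ) (x : ℂ ⊗[ℝ] g₀) :
    thetaC θ (thetaC θ x) = x := by
  induction x using TensorProduct.induction_on with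
  | zero => simp
  | add x x' hx hx' => simp [hx, hx']
  | tmul c x => simp [thetaC, hθ.involutive]

variable {h : ℂ ⊗[ℝ] g₀} {H : LieSubalgebra ℂ (ℂ ⊗[ℝ] g₀)} {t a : Submodule ℂ (ℂ ⊗[ℝ] g₀)}

lemma IsMaximallyCompact.h_mem_H (hH : IsMaximallyCompact θ h H t a) : h ∈ H := by
  have : h ∈ H.toSubmodule := hH.sup_eq ▸ Submodule.mem_sup_left hH.h_mem
  exact this

lemma IsMaximallyCompact.stable (hH : IsMaximallyCompact θ h H t a) :
    ∀ x ∈ H, thetaC θ x ∈ H := by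
  intro x hx
  have hx' : x ∈ t ⊔ a := by rw [hH.sup_eq]; exact hx
  obtain ⟨y, hy, z, hz, rfl⟩ := Submodule.mem_sup.mp hx'
  rw [map_add, thetaC_of_mem_k (hH.t_maximal.prop.1 hy), thetaC_of_mem_p (hH.a_maximal.prop.1 hz)]
  have : y + -z ∈ t ⊔ a := add_mem (Submodule.mem_sup_left hy)
    (Submodule.mem_sup_right (neg_mem hz))
  rw [hH.sup_eq] at this
  exact this

end basic

/-- The complexification of a semisimple real Lie algebra has non-degenerate Killing form. -/
instance instIsKillingComplexification {g₀ : Type*} [LieRing g₀] [LieAlgebra ℝ g₀]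
    [FiniteDimensional ℝ g₀] [LieAlgebra.IsSemisimple ℝ g₀] :
    LieAlgebra.IsKilling ℂ (ℂ ⊗[ℝ] g₀) where
  killingCompl_top_eq_bot := by
    have h1 := LieAlgebra.IsKilling.killingForm_nondegenerate ℝ g₀
    have h2 : killingForm ℂ (ℂ ⊗[ℝ] g₀) = LinearMap.BilinForm.baseChange ℂ (killingForm ℝ g₀) :=
      LieModule.traceForm_baseChange ℝ g₀ g₀ ℂ
    let b := Module.finBasis ℝ g₀
    have h3 : (killingForm ℂ (ℂ ⊗[ℝ] g₀)).Nondegenerate := by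
      rw [h2, LinearMap.BilinForm.nondegenerate_iff_det_ne_zero (b.baseChange ℂ)]
      have h4 : LinearMap.BilinForm.toMatrix (b.baseChange ℂ)
          (LinearMap.BilinForm.baseChange ℂ (killingForm ℝ g₀)) =
          (algebraMap ℝ ℂ).mapMatrix (LinearMap.BilinForm.toMatrix b (killingForm ℝ g₀)) := by
        ext i j
        simp [LinearMap.BilinForm.toMatrix_apply]
      rw [h4, ← RingHom.map_det]
      rw [LinearMap.BilinForm.nondegenerate_iff_det_ne_zero b] at h1
      simpa using h1
    refine (LieSubmodule.eq_bot_iff _).mpr fun x hx => h3.1 x fun y => ?_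
    rw [LieIdeal.mem_killingCompl] at hx
    rw [LieModule.traceForm_comm]
    exact hx y (LieSubmodule.mem_top y)

section roots

variable {g₀ : Type*} [LieRing g₀] [LieAlgebra ℝ g₀] [FiniteDimensional ℝ g₀]
  [LieAlgebra.IsSemisimple ℝ g₀] {θ : g₀ →ₗ⁅ℝ⁆ g₀}
  {H : LieSubalgebra ℂ (ℂ ⊗[ℝ] g₀)} [H.IsCartanSubalgebra]

/-- The root space `g_α`. -/
def rootSp (α : H.root) : Submodule ℂ (ℂ ⊗[ℝ] g₀) :=
  (rootSpace H (α : LieModule.Weight ℂ H (ℂ ⊗[ℝ] g₀))).toSubmodule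

/-- The action of `θ` on linear functionals, weights, and roots: `(θ α)(x) = α (θ x)`. -/
def thetaWeight (hθ : IsCartanInvolution θ) (hst : ∀ x ∈ H, thetaC θ x ∈ H)
    (α : LieModule.Weight ℂ H (ℂ ⊗[ℝ] g₀)) : LieModule.Weight ℂ H (ℂ ⊗[ℝ] g₀) where
  toFun x := α ⟨thetaC θ x, hst x x.2⟩
  genWeightSpace_ne_bot' := by
    obtain ⟨x, hx, hx0⟩ := α.exists_ne_zero
    suffices hmem : thetaC θ x ∈ LieModule.genWeightSpace (ℂ ⊗[ℝ] g₀)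
        (fun y : H => α ⟨thetaC θ y, hst y y.2⟩) by
      intro hbot
      rw [hbot, LieSubmodule.mem_bot] at hmem
      apply hx0
      rw [← thetaC_thetaC hθ x, hmem, map_zero]
    refine LieModule.weightSpace_le_genWeightSpace _ _ ?_
    rw [LieModule.mem_weightSpace]
    intro y
    have h1 := LieAlgebra.IsKilling.lie_eq_smul_of_mem_rootSpace hx ⟨thetaC θ y, hst y y.2⟩
    have h2 : ⁅thetaC θ (y : ℂ ⊗[ℝ] g₀), x⁆ = α ⟨thetaC θ y, hst y y.2⟩ • x := h1
    have h3 := congrArg (thetaC θ) h2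
    rw [thetaC_lie, thetaC_thetaC hθ, map_smul] at h3
    exact h3

/-- The action of `θ` on roots. -/
def thetaRoot (hθ : IsCartanInvolution θ) (hst : ∀ x ∈ H, thetaC θ x ∈ H) (α : H.root) :
    H.root :=
  ⟨thetaWeight hθ hst α, by
    have hα : (α : LieModule.Weight ℂ H (ℂ ⊗[ℝ] g₀)).IsNonZero := by
      simpa only [LieSubalgebra.root, Finset.mem_filter, Finset.mem_univ, true_and] using α.2
    simp only [LieSubalgebra.root, Finset.mem_filter, Finset.mem_univ, true_and]
    intro h0
    apply hα
    funext x
    have h1 := congrFun h0 ⟨thetaC θ x, hst x x.2⟩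
    simpa [thetaWeight, thetaC_thetaC hθ] using h1⟩

/-- The negative of a root. -/
def negRoot (α : H.root) : H.root :=
  ⟨-(α : LieModule.Weight ℂ H (ℂ ⊗[ℝ] g₀)), by
    have hα : (α : LieModule.Weight ℂ H (ℂ ⊗[ℝ] g₀)).IsNonZero := by
      simpa only [LieSubalgebra.root, Finset.mem_filter, Finset.mem_univ, true_and] using α.2
    simpa only [LieSubalgebra.root, Finset.mem_filter, Finset.mem_univ, true_and] using hα.neg⟩

/-- The non-compact length `m_α` of a root `α = ∑ nᵢ αᵢ`: the sum of the `nᵢ` over those simple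
roots `αᵢ` whose root space lies in `p`. -/
def noncompactLength (θ : g₀ →ₗ⁅ℝ⁆ g₀) (b : (rootSystem H).Base) (α : H.root) : ℤ :=
  open Classical in
  ∑ i ∈ b.support with rootSp i ≤ p θ, (b.exists_root_eq_sum_int α).choose i

/-- The weight `ω_α = α(h)`. -/
def omega {h : ℂ ⊗[ℝ] g₀} (hh : h ∈ H) (α : H.root) : ℂ :=
  (rootSystem H).root α ⟨h, hh⟩

/-- `α = γ + θ γ` as linear functionals. -/
def IsFolded (hθ : IsCartanInvolution θ) (hst : ∀ x ∈ H, thetaC θ x ∈ H) (α γ : H.root) : Prop :=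
  (rootSystem H).root α = (rootSystem H).root γ + (rootSystem H).root (thetaRoot hθ hst γ)

/-- The set `M_k^(j)`. -/
def Mk (hθ : IsCartanInvolution θ) (hst : ∀ x ∈ H, thetaC θ x ∈ H) {h : ℂ ⊗[ℝ] g₀} (hh : h ∈ H)
    (b : (rootSystem H).Base) (j : ℤ) : Set H.root :=
  {α | b.IsPos α ∧ omega hh α = j ∧ thetaRoot hθ hst α = α ∧ Even (noncompactLength θ b α) ∧
    ¬ ∃ γ, b.IsPos γ ∧ IsFolded hθ hst α γ}

/-- The set `M_p^(j)`. -/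
def Mp (hθ : IsCartanInvolution θ) (hst : ∀ x ∈ H, thetaC θ x ∈ H) {h : ℂ ⊗[ℝ] g₀} (hh : h ∈ H)
    (b : (rootSystem H).Base) (j : ℤ) : Set H.root :=
  {α | b.IsPos α ∧ omega hh α = j ∧ thetaRoot hθ hst α = α ∧ Odd (noncompactLength θ b α)} ∪
  {α | b.IsPos α ∧ ∃ γ, b.IsPos γ ∧ IsFolded hθ hst α γ ∧ 2 * omega hh γ = j}

/-- The set `C^(j)` of complex pairs `{α, θ α}`. -/
def Cpairs (hθ : IsCartanInvolution θ) (hst : ∀ x ∈ H, thetaC θ x ∈ H) {h : ℂ ⊗[ℝ] g₀}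
    (hh : h ∈ H) (b : (rootSystem H).Base) (j : ℤ) : Set (Sym2 H.root) :=
  {q | ∃ α, q = s(α, thetaRoot hθ hst α) ∧ b.IsPos α ∧ thetaRoot hθ hst α ≠ α ∧
    omega hh α = j}

/-- `± M` for a set `M` of roots. -/
def pmRoots (M : Set H.root) : Set H.root := M ∪ negRoot '' M

/-- `± C` for a set `C` of pairs of roots. -/
def pmPairs (C : Set (Sym2 H.root)) : Set (Sym2 H.root) := C ∪ Sym2.map negRoot '' C

end roots

/-- The eigenspace `g^(j)` of `ad h`. -/
def grade {g : Type*} [LieRing g] [LieAlgebra ℂ g] (h : g) (j : ℤ) : Submodule ℂ g :=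
  Module.End.eigenspace (LieAlgebra.ad ℂ g h) (j : ℂ)

/-- The subspace `V` is the internal direct sum of the family `F` of subspaces. -/
def IsInternalSum {g ι : Type*} [AddCommGroup g] [Module ℂ g] (V : Submodule ℂ g)
    (F : ι → Submodule ℂ g) : Prop :=
  iSupIndep F ∧ ⨆ i, F i = V

/-- The family of subspaces consisting of the root spaces `g_α` for `α ∈ M` and of the lines
`ℂ v_q` for the pairs `q ∈ C`. -/
def summands {g₀ : Type*} [LieRing g₀] [LieAlgebra ℝ g₀] [FiniteDimensional ℝ g₀]
    [LieAlgebra.IsSemisimple ℝ g₀] {H : LieSubalgebra ℂ (ℂ ⊗[ℝ] g₀)} [H.IsCartanSubalgebra]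
    (M : Set H.root) (C : Set (Sym2 H.root)) (v : Sym2 H.root → ℂ ⊗[ℝ] g₀) :
    M ⊕ C → Submodule ℂ (ℂ ⊗[ℝ] g₀) :=
  Sum.elim (fun α => rootSp (α : H.root)) (fun q => Submodule.span ℂ {v (q : Sym2 H.root)})

/-- The family `summands M C v` together with one further subspace `s`. -/
def summandsWith {g₀ : Type*} [LieRing g₀] [LieAlgebra ℝ g₀] [FiniteDimensional ℝ g₀]
    [LieAlgebra.IsSemisimple ℝ g₀] {H : LieSubalgebra ℂ (ℂ ⊗[ℝ] g₀)} [H.IsCartanSubalgebra]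
    (s : Submodule ℂ (ℂ ⊗[ℝ] g₀))
    (M : Set H.root) (C : Set (Sym2 H.root)) (v : Sym2 H.root → ℂ ⊗[ℝ] g₀) :
    Option (M ⊕ C) → Submodule ℂ (ℂ ⊗[ℝ] g₀) :=
  fun i => i.elim s (summands M C v)

end SymmetricPair

end

/-! The spaces in question are cut out by `ad h`, which is scalar on every root space, and by `θ`,
which permutes the root spaces and preserves weights because `θ h = h`. For `ε = ±1` the map `x ↦ x
+ ε θ x` is twice the projection onto the `ε`-eigenspace of `θ`. Applied to root spaces, it yields
one line for each pair `{α, θ α}` with `θ α ≠ α`, and everything or nothing for a fixed root, on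
whose root space `θ` is a sign. This is `isInternalSum_summandsWith`; independence is inherited from
the root spaces.

What remains is the sign at a fixed positive root `α`. If `α = γ + θ γ`, then `g_α` is spanned by
some `[x, θ x]`, which `θ` negates (`IsFolded.actsBy`). Otherwise the sign is `(-1) ^ m_α`
(`actsBy_of_not_isFolded`), by induction on the height. Unless `α` is simple, choose a simple `β`
pairing positively with `α` and lower `α` by a Weyl group element commuting with `θ`: `s_β` if `θ β
= β`; `s_β s_θβ` if `β` and `θ β` are orthogonal; `s_β s_θβ s_β`, the reflection in `β + θ β`, if
they span a system of type `A₂`. Such an element carries folded roots to folded roots. Climbing back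
along root strings, where brackets do not vanish (`lie_ne_zero_of_mem_rootSpace`), shows that the
sign and the parity of `m_α` change together. -/

/-! ### Preliminaries on independent families and brackets -/

namespace iSupIndep

/-- Regrouping the members of an independent family along pairwise disjoint sets of indices, and
passing to smaller submodules, gives an independent family. -/
lemma of_le_biSup {α ι κ : Type*} [CompleteLattice α] [IsModularLattice α]
    [IsCompactlyGenerated α] {f : ι → α} (hf : iSupIndep f) {F : κ → α} {w : κ → Set ι}
    (hw : ∀ i j x, x ∈ w i → x ∈ w j → i = j) (hF : ∀ i, F i ≤ ⨆ x ∈ w i, f x) :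
    iSupIndep F := by
  intro i
  have hd : Disjoint (w i) (⋃ (j) (_ : j ≠ i), w j) := by
    rw [Set.disjoint_left]
    intro x hx hx'
    simp only [Set.mem_iUnion] at hx'
    obtain ⟨j, hj, hxj⟩ := hx'
    exact hj (hw _ _ _ hxj hx)
  refine (hf.disjoint_biSup_biSup hd).mono (hF i) (iSup₂_le fun j hj => (hF j).trans ?_)
  exact biSup_mono fun x hx => Set.mem_biUnion (show j ∈ {j | j ≠ i} from hj) hx

end iSupIndep

lemma lie_smul_lie_smul {R L : Type*} [CommRing R] [LieRing L] [LieAlgebra R L] (c d : R)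
    (x y : L) : ⁅c • x, ⁅c • x, d • y⁆⁆ = (c * c * d) • ⁅x, ⁅x, y⁆⁆ := by
  simp only [lie_smul, smul_lie, smul_smul]
  congr 1
  ring

/-! ### Non-vanishing of brackets along root strings -/

namespace LieAlgebra.IsKilling

open LieModule

variable {K L : Type*} [Field K] [CharZero K] [LieRing L] [LieAlgebra K L] [IsKilling K L]
  [FiniteDimensional K L] {H : LieSubalgebra K L} [H.IsCartanSubalgebra]
  [IsTriangularizable K H L]

lemma exists_smul_eq_of_mem_rootSpace {α : Weight K H L} (hα : α.IsNonZero) {x y : L}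
    (hx : x ∈ rootSpace H α) (hx0 : x ≠ 0) (hy : y ∈ rootSpace H α) : ∃ c : K, y = c • x := by
  obtain ⟨c, hc⟩ := (finrank_eq_one_iff_of_nonzero' (⟨x, hx⟩ : rootSpace H α)
    (by simpa using hx0)).mp (finrank_rootSpace_eq_one α hα) ⟨y, hy⟩
  exact ⟨c, (congrArg Subtype.val hc).symm⟩

/-- If `α`, `β` are roots and `α + β` is a weight then `[g_α, g_β]` is non-zero. -/
lemma lie_ne_zero_of_mem_rootSpace {α β : Weight K H L} (hα : α.IsNonZero) (hβ : β.IsNonZero)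
    (hαβ : rootSpace H (α + β : H → K) ≠ ⊥) {x y : L} (hx : x ∈ rootSpace H α) (hx0 : x ≠ 0)
    (hy : y ∈ rootSpace H β) (hy0 : y ≠ 0) : ⁅x, y⁆ ≠ 0 := by
  obtain ⟨h, e, f, isSl2, he, hf⟩ := exists_isSl2Triple_of_weight_isNonZero hα
  obtain rfl := isSl2.h_eq_coroot hα he hf
  -- A vector at the top of the `α`-string through `β` is primitive for the `sl₂` of `α`. Applying
  -- `f` as often as `β` lies below the top reaches the line `g_β`, so `y` is a multiple of `f ^ (n
  -- + 1) z`, and `e` acts on that by an explicit scalar.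
  obtain ⟨z, hz, hz0⟩ := (chainTop α β).exists_ne_zero
  have prim : isSl2.HasPrimitiveVectorWith z (chainLength α β : K) :=
    have := lie_mem_genWeightSpace_of_mem_genWeightSpace he hz
    ⟨hz0, (chainLength_smul _ _ hz).symm, by rwa [genWeightSpace_add_chainTop _ _ hα] at this⟩
  have h1 : 1 ≤ chainTopCoeff α β := by
    have := ((rootSpace_zsmul_add_ne_bot_iff α β hα 1).mp (by rwa [one_smul])).1
    exact_mod_cast this
  obtain ⟨n, hn⟩ : ∃ n, chainTopCoeff α β = n + 1 := ⟨_, (Nat.sub_add_cancel h1).symm⟩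
  have hle : n + 1 ≤ chainLength α β := hn ▸ chainTopCoeff_le_chainLength α β
  have hmem : ((toEnd K L L f) ^ (n + 1)) z ∈ rootSpace H β := by
    have := toEnd_pow_apply_mem hf hz (n + 1)
    convert this using 2
    rw [coe_chainTop', hn, smul_neg, neg_add_cancel_left]
  obtain ⟨c, rfl⟩ := exists_smul_eq_of_mem_rootSpace hβ hmem
    (prim.pow_toEnd_f_ne_zero_of_eq_nat rfl hle) hy
  obtain ⟨d, rfl⟩ := exists_smul_eq_of_mem_rootSpace hα he isSl2.e_ne_zero hx
  have hc : c ≠ 0 := by rintro rfl; simp at hy0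
  have hd : d ≠ 0 := by rintro rfl; simp at hx0
  rw [smul_lie, lie_smul, prim.lie_e_pow_succ_toEnd_f]
  have hn0 : ((n : K) + 1) * (chainLength α β - n) ≠ 0 := by
    refine mul_ne_zero (by exact_mod_cast n.succ_ne_zero) (sub_ne_zero.mpr ?_)
    exact_mod_cast (Nat.lt_of_succ_le hle).ne'
  exact smul_ne_zero hd (smul_ne_zero hc (smul_ne_zero hn0
    (prim.pow_toEnd_f_ne_zero_of_eq_nat rfl (Nat.le_of_succ_le hle))))

/-- If `β` and `α = β + n δ` are roots, with `β` not proportional to `δ`, then `(ad e)^n` is non-zero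
on `g_β` for `0 ≠ e ∈ g_δ`. -/
lemma toEnd_pow_apply_ne_zero_of_mem_rootSpace {δ β : Weight K H L} (hδ : δ.IsNonZero)
    (hβδ : ∀ k : ℤ, k • (δ : H → K) + β ≠ 0) {n : ℕ}
    (hn : rootSpace H (n • δ + β : H → K) ≠ ⊥) {e y : L} (he : e ∈ rootSpace H δ) (he0 : e ≠ 0)
    (hy : y ∈ rootSpace H β) (hy0 : y ≠ 0) : ((toEnd K L L e) ^ n) y ≠ 0 := by
  induction n with
  | zero => simpa using hy0
  | succ n ih =>
    -- Root strings have no gaps, so the intermediate functional is again a weight.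
    have hn' : rootSpace H (n • δ + β : H → K) ≠ ⊥ := by
      have h1 := (rootSpace_zsmul_add_ne_bot_iff δ β hδ ((n + 1 : ℕ) : ℤ)).mp
        (by rwa [natCast_zsmul])
      have h2 := (rootSpace_zsmul_add_ne_bot_iff δ β hδ (n : ℤ)).mpr
        ⟨by push_cast at h1; lia, by push_cast at h1; lia⟩
      rwa [natCast_zsmul] at h2
    let W : Weight K H L := ⟨n • δ + β, hn'⟩
    have hW : W.IsNonZero := fun h0 => hβδ n (by rw [natCast_zsmul]; exact h0)
    rw [pow_succ', Module.End.mul_apply, toEnd_apply_apply]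
    refine lie_ne_zero_of_mem_rootSpace (β := W) hδ hW ?_ he he0 (toEnd_pow_apply_mem he hy n)
      (ih hn')
    convert hn using 2
    change (δ : H → K) + (n • (δ : H → K) + β) = _
    rw [succ_nsmul', add_assoc]

end LieAlgebra.IsKilling

/-! ### The action of `θ` on `g`, roots, coroots and root spaces -/

noncomputable section

namespace SymmetricPair

section eigen

variable {g₀ : Type*} [LieRing g₀] [LieAlgebra ℝ g₀] {θ : g₀ →ₗ⁅ℝ⁆ g₀}

lemma add_thetaC_mem_k (hθ : IsCartanInvolution θ) (x : ℂ ⊗[ℝ] g₀) : x + thetaC θ x ∈ k θ := by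
  induction x using TensorProduct.induction_on with
  | zero => simp
  | add x y hx hy => rw [map_add, add_add_add_comm]; exact add_mem hx hy
  | tmul c x =>
    have : c ⊗ₜ[ℝ] x + thetaC θ (c ⊗ₜ[ℝ] x) = c ⊗ₜ[ℝ] (x + θ x) := by
      simp [thetaC, TensorProduct.tmul_add]
    rw [this]
    refine Submodule.tmul_mem_baseChange_of_mem c ?_
    simp [k₀, hθ.involutive, add_comm]

lemma sub_thetaC_mem_p (hθ : IsCartanInvolution θ) (x : ℂ ⊗[ℝ] g₀) : x - thetaC θ x ∈ p θ := by
  induction x using TensorProduct.induction_on with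
  | zero => simp
  | add x y hx hy => rw [map_add, add_sub_add_comm]; exact add_mem hx hy
  | tmul c x =>
    have : c ⊗ₜ[ℝ] x - thetaC θ (c ⊗ₜ[ℝ] x) = c ⊗ₜ[ℝ] (x - θ x) := by
      simp [thetaC, TensorProduct.tmul_sub]
    rw [this]
    refine Submodule.tmul_mem_baseChange_of_mem c ?_
    simp [p₀, hθ.involutive]

lemma mem_k_iff (hθ : IsCartanInvolution θ) {x : ℂ ⊗[ℝ] g₀} : x ∈ k θ ↔ thetaC θ x = x := by
  refine ⟨thetaC_of_mem_k, fun hx => ?_⟩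
  have h1 := Submodule.smul_mem _ (2⁻¹ : ℂ) (add_thetaC_mem_k hθ x)
  rwa [hx, ← two_smul ℂ x, inv_smul_smul₀ two_ne_zero] at h1

lemma mem_p_iff (hθ : IsCartanInvolution θ) {x : ℂ ⊗[ℝ] g₀} : x ∈ p θ ↔ thetaC θ x = -x := by
  refine ⟨thetaC_of_mem_p, fun hx => ?_⟩
  have h1 := Submodule.smul_mem _ (2⁻¹ : ℂ) (sub_thetaC_mem_p hθ x)
  rwa [hx, sub_neg_eq_add, ← two_smul ℂ x, inv_smul_smul₀ two_ne_zero] at h1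

end eigen

variable {g₀ : Type*} [LieRing g₀] [LieAlgebra ℝ g₀] [FiniteDimensional ℝ g₀]
  [LieAlgebra.IsSemisimple ℝ g₀] {θ : g₀ →ₗ⁅ℝ⁆ g₀}
  {H : LieSubalgebra ℂ (ℂ ⊗[ℝ] g₀)} [H.IsCartanSubalgebra]

/-- The restriction of `θ` to a `θ`-stable subalgebra. -/
def thetaRestrict {H : LieSubalgebra ℂ (ℂ ⊗[ℝ] g₀)} (hst : ∀ x ∈ H, thetaC θ x ∈ H) :
    H →ₗ[ℂ] H :=
  (thetaC θ).restrict (p := H.toSubmodule) (q := H.toSubmodule) hst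

/-- The action of `θ` on linear functionals. -/
def thetaDual {H : LieSubalgebra ℂ (ℂ ⊗[ℝ] g₀)} (hst : ∀ x ∈ H, thetaC θ x ∈ H) :
    Module.Dual ℂ H →ₗ[ℂ] Module.Dual ℂ H :=
  (thetaRestrict hst).dualMap

variable (hθ : IsCartanInvolution θ) (hst : ∀ x ∈ H, thetaC θ x ∈ H)

lemma root_thetaRoot (α : H.root) :
    (rootSystem H).root (thetaRoot hθ hst α) = thetaDual hst ((rootSystem H).root α) := rfl

include hθ in
lemma thetaDual_thetaDual (φ : Module.Dual ℂ H) : thetaDual hst (thetaDual hst φ) = φ := by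
  ext x
  exact congrArg φ (Subtype.ext (thetaC_thetaC hθ x))

lemma thetaRoot_thetaRoot (α : H.root) : thetaRoot hθ hst (thetaRoot hθ hst α) = α := by
  apply (rootSystem H).root.injective
  rw [root_thetaRoot, root_thetaRoot, thetaDual_thetaDual hθ]

lemma root_negRoot (α : H.root) :
    (rootSystem H).root (negRoot α) = -(rootSystem H).root α := rfl

lemma negRoot_negRoot (α : H.root) : negRoot (negRoot α) = α := by
  apply (rootSystem H).root.injective
  rw [root_negRoot, root_negRoot, neg_neg]

lemma negRoot_injective : Function.Injective (negRoot (H := H)) :=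
  Function.LeftInverse.injective negRoot_negRoot

lemma thetaRoot_negRoot (α : H.root) :
    thetaRoot hθ hst (negRoot α) = negRoot (thetaRoot hθ hst α) := rfl

/-- A Cartan subalgebra acts semisimply when the Killing form is non-degenerate, so generalized
weight vectors are eigenvectors. -/
lemma mem_rootSp_iff {α : H.root} {x : ℂ ⊗[ℝ] g₀} :
    x ∈ rootSp α ↔ ∀ y : H, ⁅(y : ℂ ⊗[ℝ] g₀), x⁆ = (rootSystem H).root α y • x := by
  refine ⟨fun hx y => lie_eq_smul_of_mem_rootSpace hx y, fun hx => ?_⟩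
  refine LieModule.weightSpace_le_genWeightSpace _ _ ?_
  rw [LieModule.mem_weightSpace]
  exact hx

lemma thetaC_mem_rootSp {α : H.root} {x : ℂ ⊗[ℝ] g₀} (hx : x ∈ rootSp α) :
    thetaC θ x ∈ rootSp (thetaRoot hθ hst α) := by
  rw [mem_rootSp_iff] at hx ⊢
  intro y
  have h1 := congrArg (thetaC θ) (hx (thetaRestrict hst y))
  rw [thetaC_lie, map_smul] at h1
  rw [← show thetaC θ (thetaRestrict hst y : ℂ ⊗[ℝ] g₀) = y from thetaC_thetaC hθ _]
  exact h1

lemma thetaC_ne_zero {x : ℂ ⊗[ℝ] g₀} (hθ : IsCartanInvolution θ) (hx : x ≠ 0) :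
    thetaC θ x ≠ 0 := by
  intro h0
  apply hx
  rw [← thetaC_thetaC hθ x, h0, map_zero]

lemma exists_ne_zero_mem_rootSp (α : H.root) : ∃ x ∈ rootSp α, x ≠ 0 :=
  (α : LieModule.Weight ℂ H (ℂ ⊗[ℝ] g₀)).exists_ne_zero

lemma eq_of_mem_rootSp {α β : H.root} {x : ℂ ⊗[ℝ] g₀} (hx : x ∈ rootSp α) (hx' : x ∈ rootSp β)
    (hx0 : x ≠ 0) : α = β := by
  apply (rootSystem H).root.injective
  ext y
  rw [mem_rootSp_iff] at hx hx'
  exact smul_left_injective ℂ hx0 ((hx y).symm.trans (hx' y))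

lemma isNonZero_of_root (α : H.root) : α.1.IsNonZero := (Finset.mem_filter.mp α.2).2

lemma lie_mem_rootSp {α β γ : H.root}
    (hγ : (rootSystem H).root γ = (rootSystem H).root α + (rootSystem H).root β)
    {x y : ℂ ⊗[ℝ] g₀} (hx : x ∈ rootSp α) (hy : y ∈ rootSp β) : ⁅x, y⁆ ∈ rootSp γ := by
  have h1 := lie_mem_genWeightSpace_of_mem_genWeightSpace (H := H) (M := ℂ ⊗[ℝ] g₀) hx hy
  rwa [← show (α.1 + β.1 : H → ℂ) = _ from rfl,
    ← show (γ.1 : H → ℂ) = α.1 + β.1 from congrArg (DFunLike.coe (F := Module.Dual ℂ H)) hγ] at h1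

lemma lie_ne_zero_of_mem_rootSp {α β γ : H.root}
    (hγ : (rootSystem H).root γ = (rootSystem H).root α + (rootSystem H).root β)
    {x y : ℂ ⊗[ℝ] g₀} (hx : x ∈ rootSp α) (hx0 : x ≠ 0) (hy : y ∈ rootSp β) (hy0 : y ≠ 0) :
    ⁅x, y⁆ ≠ 0 := by
  refine lie_ne_zero_of_mem_rootSpace (H := H) (isNonZero_of_root α) (isNonZero_of_root β) ?_ hx hx0 hy hy0
  rw [← show (γ.1 : H → ℂ) = α.1 + β.1 from congrArg (DFunLike.coe (F := Module.Dual ℂ H)) hγ]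
  exact γ.1.genWeightSpace_ne_bot

/-- The root system is reduced: `± δ` are the only roots proportional to `δ`. Excluding them keeps a
root string away from zero. -/
lemma zsmul_root_add_ne_zero {β δ : H.root} (h1 : β ≠ δ) (h2 : β ≠ negRoot δ) (m : ℤ) :
    m • (rootSystem H).root δ + (rootSystem H).root β ≠ 0 := by
  intro h0
  rcases eq_neg_or_eq_of_eq_smul (H := H) δ.1 β.1 (isNonZero_of_root β) (-(m : ℂ)) (by
      have h3 : (rootSystem H).root β = (-(m : ℂ)) • (rootSystem H).root δ := by
        rw [neg_smul, Int.cast_smul_eq_zsmul]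
        exact (neg_eq_of_add_eq_zero_right h0).symm
      exact congrArg (DFunLike.coe (F := Module.Dual ℂ H)) h3) with h | h
  · exact h2 (Subtype.ext h)
  · exact h1 (Subtype.ext h)

lemma toEnd_pow_apply_mem_rootSp {α β δ : H.root} {n : ℕ}
    (hα : (rootSystem H).root α = (rootSystem H).root β + n • (rootSystem H).root δ)
    {e y : ℂ ⊗[ℝ] g₀} (he : e ∈ rootSp δ) (hy : y ∈ rootSp β) :
    ((LieModule.toEnd ℂ (ℂ ⊗[ℝ] g₀) (ℂ ⊗[ℝ] g₀) e) ^ n) y ∈ rootSp α := by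
  have h2 : (α.1 : H → ℂ) =
    n • (δ.1 : H → ℂ) +
    (β.1 : H → ℂ) := by
    rw [add_comm]
    exact congrArg (DFunLike.coe (F := Module.Dual ℂ H)) hα
  have h1 := toEnd_pow_apply_mem (H := H) (M := ℂ ⊗[ℝ] g₀) he hy n
  rwa [← h2] at h1

lemma toEnd_pow_apply_ne_zero_of_mem_rootSp {α β δ : H.root} {n : ℕ}
    (hα : (rootSystem H).root α = (rootSystem H).root β + n • (rootSystem H).root δ)
    (h1 : β ≠ δ) (h2 : β ≠ negRoot δ)
    {e y : ℂ ⊗[ℝ] g₀} (he : e ∈ rootSp δ) (he0 : e ≠ 0) (hy : y ∈ rootSp β) (hy0 : y ≠ 0) :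
    ((LieModule.toEnd ℂ (ℂ ⊗[ℝ] g₀) (ℂ ⊗[ℝ] g₀) e) ^ n) y ≠ 0 := by
  have h3 : (α.1 : H → ℂ) =
    n • (δ.1 : H → ℂ) +
    (β.1 : H → ℂ) := by
    rw [add_comm]
    exact congrArg (DFunLike.coe (F := Module.Dual ℂ H)) hα
  refine toEnd_pow_apply_ne_zero_of_mem_rootSpace (H := H) (isNonZero_of_root δ) (fun m hm => ?_) ?_ he he0
    hy hy0
  · exact zsmul_root_add_ne_zero h1 h2 m (DFunLike.coe_injective (F := Module.Dual ℂ H) hm)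
  · rw [← h3]
    exact α.1.genWeightSpace_ne_bot

lemma thetaC_toEnd_pow_apply (n : ℕ) (x y : ℂ ⊗[ℝ] g₀) :
    thetaC θ (((LieModule.toEnd ℂ (ℂ ⊗[ℝ] g₀) (ℂ ⊗[ℝ] g₀) x) ^ n) y) =
      ((LieModule.toEnd ℂ (ℂ ⊗[ℝ] g₀) (ℂ ⊗[ℝ] g₀) (thetaC θ x)) ^ n) (thetaC θ y) := by
  induction n with
  | zero => simp
  | succ n ih =>
    rw [pow_succ', pow_succ', Module.End.mul_apply, Module.End.mul_apply,
      LieModule.toEnd_apply_apply, LieModule.toEnd_apply_apply, thetaC_lie, ih]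

/-- An automorphism carries an `sl₂`-triple for `β` to one for `θ β`, and the neutral element of
such a triple is always the coroot. -/
lemma coroot_thetaRoot (β : H.root) : (rootSystem H).coroot (thetaRoot hθ hst β) =
    thetaRestrict hst ((rootSystem H).coroot β) := by
  obtain ⟨h, e, f, isSl2, he, hf⟩ := exists_isSl2Triple_of_weight_isNonZero (H := H)
    (isNonZero_of_root β)
  have hh := isSl2.h_eq_coroot (H := H) (isNonZero_of_root β) he hf
  have isSl2' : IsSl2Triple (thetaC θ h) (thetaC θ e) (thetaC θ f) :=
    { h_ne_zero := thetaC_ne_zero hθ isSl2.h_ne_zero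
      lie_e_f := by rw [← thetaC_lie, isSl2.lie_e_f]
      lie_h_e_nsmul := by rw [← thetaC_lie, isSl2.lie_h_e_nsmul, map_nsmul]
      lie_h_f_nsmul := by rw [← thetaC_lie, isSl2.lie_h_f_nsmul, map_neg, map_nsmul] }
  have he' := thetaC_mem_rootSp hθ hst (α := β) he
  have hf' := thetaC_mem_rootSp hθ hst (α := negRoot β) hf
  have hh' := isSl2'.h_eq_coroot (H := H) (isNonZero_of_root (thetaRoot hθ hst β)) he' hf'
  apply Subtype.ext
  rw [rootSystem_coroot_apply, rootSystem_coroot_apply, ← hh', hh]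
  rfl

lemma pairing_thetaRoot (α β : H.root) :
    (rootSystem H).pairing (thetaRoot hθ hst α) (thetaRoot hθ hst β) =
      (rootSystem H).pairing α β := by
  change (rootSystem H).root (thetaRoot hθ hst α) ((rootSystem H).coroot (thetaRoot hθ hst β)) =
    (rootSystem H).root α ((rootSystem H).coroot β)
  rw [coroot_thetaRoot, root_thetaRoot]
  exact congrArg ((rootSystem H).root α) (Subtype.ext (thetaC_thetaC hθ _))

lemma pairingIn_thetaRoot (α β : H.root) :
    (rootSystem H).pairingIn ℤ (thetaRoot hθ hst α) (thetaRoot hθ hst β) =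
      (rootSystem H).pairingIn ℤ α β := by
  apply (algebraMap ℤ ℂ).injective_int
  rw [RootPairing.algebraMap_pairingIn, RootPairing.algebraMap_pairingIn, pairing_thetaRoot]

/-! ### Heights and non-compact lengths -/

section base

variable (b : (rootSystem H).Base)

lemma height_negRoot (α : H.root) : b.height (negRoot α) = -b.height α := by
  have : negRoot α = (rootSystem H).reflectionPerm α α := by
    apply (rootSystem H).root.injective
    rw [root_negRoot, RootPairing.root_reflectionPerm, RootPairing.reflection_apply_self]
  rw [this]
  exact b.height_reflectionPerm_self α

lemma isPos_or_isPos_negRoot (α : H.root) : b.IsPos α ∨ b.IsPos (negRoot α) := by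
  have := b.height_ne_zero α
  rw [RootPairing.Base.isPos_iff, RootPairing.Base.isPos_iff, height_negRoot]
  lia

variable {b} (hb : ∀ β ∈ b.support, thetaRoot hθ hst β ∈ b.support)

include hb in
-- Height is additive and `θ` preserves the set of simple roots, all of height one.
lemma height_thetaRoot (α : H.root) : b.height (thetaRoot hθ hst α) = b.height α := by
  have key : ∀ α, b.IsPos α → b.height (thetaRoot hθ hst α) = b.height α := by
    intro α hα
    refine RootPairing.Base.IsPos.induction_on_add hα
      (p := fun α => b.height (thetaRoot hθ hst α) = b.height α) (fun i hi => ?_)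
      (fun i j l hl hi hj => ?_)
    · rw [RootPairing.Base.height_one_of_mem_support hi,
        RootPairing.Base.height_one_of_mem_support (hb i hi)]
    · have hl' : (rootSystem H).root (thetaRoot hθ hst l) =
          (rootSystem H).root (thetaRoot hθ hst i) + (rootSystem H).root (thetaRoot hθ hst j) := by
        rw [root_thetaRoot, hl, map_add, root_thetaRoot, root_thetaRoot]
      rw [b.height_add hl, b.height_add hl', hi, RootPairing.Base.height_one_of_mem_support hj,
        RootPairing.Base.height_one_of_mem_support (hb j hj)]
  rcases isPos_or_isPos_negRoot b α with h | h
  · exact key α h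
  · have := key _ h
    rw [thetaRoot_negRoot, height_negRoot, height_negRoot] at this
    exact neg_injective this

include hb in
lemma IsFolded.isPos {α γ : H.root} (h : IsFolded hθ hst α γ) (hα : b.IsPos α) : b.IsPos γ := by
  rw [RootPairing.Base.isPos_iff] at hα ⊢
  rw [b.height_add h, height_thetaRoot hθ hst hb] at hα
  lia

/-- The definition uses chosen coefficients; linear independence of the simple roots makes any
integral expansion as good. Additivity follows. -/
lemma noncompactLength_eq_sum {α : H.root} {f : H.root → ℤ}
    (heq : (rootSystem H).root α = ∑ i ∈ b.support, f i • (rootSystem H).root i) :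
    noncompactLength θ b α = (open Classical in ∑ i ∈ b.support with rootSp i ≤ p θ, f i) := by
  classical
  have h1 : ∀ i ∈ b.support, (b.exists_root_eq_sum_int α).choose i = f i := by
    intro i hi
    have h2 := (b.exists_root_eq_sum_int α).choose_spec.2.2
    have h3 := linearIndepOn_finset_iff.mp (b.linearIndepOn_root.restrict_scalars' ℤ)
      (fun i => (b.exists_root_eq_sum_int α).choose i - f i)
      (by simp only [sub_smul, Finset.sum_sub_distrib]; rw [← h2, ← heq, sub_self]) i hi
    exact sub_eq_zero.mp h3
  exact Finset.sum_congr (by congr) fun i hi => h1 i (Finset.mem_filter.mp hi).1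

lemma noncompactLength_add_zsmul {α β γ : H.root} {z : ℤ}
    (hα : (rootSystem H).root α = (rootSystem H).root β + z • (rootSystem H).root γ) :
    noncompactLength θ b α = noncompactLength θ b β + z * noncompactLength θ b γ := by
  obtain ⟨f, -, -, hf⟩ := b.exists_root_eq_sum_int β
  obtain ⟨g, -, -, hg⟩ := b.exists_root_eq_sum_int γ
  have hfg : (rootSystem H).root α =
      ∑ l ∈ b.support, (fun l => f l + z * g l) l • (rootSystem H).root l := by
    simp only [add_smul, mul_smul, Finset.sum_add_distrib, ← Finset.smul_sum, ← hf, ← hg, hα]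
  rw [noncompactLength_eq_sum hf, noncompactLength_eq_sum hg, noncompactLength_eq_sum hfg,
    Finset.sum_add_distrib, Finset.mul_sum]

lemma noncompactLength_of_mem_support {β : H.root} (hβ : β ∈ b.support) :
    noncompactLength θ b β = (open Classical in if rootSp β ≤ p θ then 1 else 0) := by
  classical
  have : (rootSystem H).root β =
      ∑ j ∈ b.support, (Pi.single β 1 : H.root → ℤ) j • (rootSystem H).root j := by
    rw [Finset.sum_eq_single_of_mem β hβ (by simp_all)]; simp
  rw [noncompactLength_eq_sum this]
  simp [Pi.single_apply, Finset.sum_ite_eq', hβ]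

end base

end SymmetricPair
end

/-! ### The sign of `θ` on the root space of a fixed root -/

noncomputable section

namespace SymmetricPair

variable {g₀ : Type*} [LieRing g₀] [LieAlgebra ℝ g₀] [FiniteDimensional ℝ g₀]
  [LieAlgebra.IsSemisimple ℝ g₀] {θ : g₀ →ₗ⁅ℝ⁆ g₀}
  {H : LieSubalgebra ℂ (ℂ ⊗[ℝ] g₀)} [H.IsCartanSubalgebra]

/-- `θ` acts on the root space `g_α` as multiplication by `c`. -/
def ActsBy (θ : g₀ →ₗ⁅ℝ⁆ g₀) (α : H.root) (c : ℂ) : Prop :=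
  ∀ x ∈ rootSp α, thetaC θ x = c • x

lemma actsBy_of_mem {α : H.root} {c : ℂ} {x : ℂ ⊗[ℝ] g₀} (hx : x ∈ rootSp α) (hx0 : x ≠ 0)
    (h : thetaC θ x = c • x) : ActsBy θ α c := by
  intro y hy
  obtain ⟨d, rfl⟩ := exists_smul_eq_of_mem_rootSpace (H := H) (isNonZero_of_root α) hx hx0 hy
  rw [map_smul, h, smul_comm]

lemma ActsBy.unique {α : H.root} {c d : ℂ} (hc : ActsBy θ α c) (hd : ActsBy θ α d) : c = d := by
  obtain ⟨x, hx, hx0⟩ := exists_ne_zero_mem_rootSp α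
  exact smul_left_injective ℂ hx0 ((hc x hx).symm.trans (hd x hx))

variable (hθ : IsCartanInvolution θ) (hst : ∀ x ∈ H, thetaC θ x ∈ H)

lemma exists_actsBy {α : H.root} (hα : thetaRoot hθ hst α = α) :
    ActsBy θ α 1 ∨ ActsBy θ α (-1) := by
  obtain ⟨x, hx, hx0⟩ := exists_ne_zero_mem_rootSp α
  have h1 := thetaC_mem_rootSp hθ hst hx
  rw [hα] at h1
  obtain ⟨c, hc⟩ := exists_smul_eq_of_mem_rootSpace (H := H) (isNonZero_of_root α) hx hx0 h1
  have h2 := thetaC_thetaC hθ x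
  rw [hc, map_smul, hc, smul_smul] at h2
  have h3 : c * c = 1 := smul_left_injective ℂ hx0 (h2.trans (one_smul ℂ x).symm)
  rcases mul_self_eq_one_iff.mp h3 with rfl | rfl
  · exact Or.inl (actsBy_of_mem hx hx0 hc)
  · exact Or.inr (actsBy_of_mem hx hx0 hc)

/-- Applying `θ` to `[e, [e, f]] = -2 e` gives `c² d = c` for the signs `c`, `d` at `α`, `-α`, and
`c² = 1`. -/
lemma ActsBy.negRoot {α : H.root} {c : ℂ} (hα : thetaRoot hθ hst α = α) (hc : ActsBy θ α c) :
    ActsBy θ (negRoot α) c := by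
  obtain ⟨h, e, f, isSl2, he, hf⟩ := exists_isSl2Triple_of_weight_isNonZero (H := H)
    (isNonZero_of_root α)
  have key : ∀ d, ActsBy θ (SymmetricPair.negRoot α) d → c * c * d = c := by
    intro d hd
    have h1 : ⁅e, ⁅e, f⁆⁆ = -(2 • e) := by rw [isSl2.lie_e_f, ← lie_skew, isSl2.lie_h_e_nsmul]
    have h2 := congrArg (thetaC θ) h1
    rw [thetaC_lie, thetaC_lie, map_neg, map_nsmul, hc e he, hd f hf, smul_comm 2 c,
      ← smul_neg] at h2
    replace h2 := (lie_smul_lie_smul c d e f).symm.trans h2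
    rw [h1] at h2
    have h3 : -(2 • e) ≠ 0 := by
      rw [two_nsmul, ← two_smul ℂ e]
      exact neg_ne_zero.mpr (smul_ne_zero two_ne_zero isSl2.e_ne_zero)
    exact smul_left_injective ℂ h3 h2
  have hc1 : c * c = 1 := by
    rcases exists_actsBy hθ hst hα with h1 | h1 <;> rw [hc.unique h1] <;> norm_num
  rcases exists_actsBy hθ hst (α := SymmetricPair.negRoot α)
    (by rw [thetaRoot_negRoot, hα]) with h1 | h1 <;> rwa [← key _ h1, hc1, one_mul]

/-- `θ` acts by `-1` on the root space of a root of the form `γ + θ γ`. -/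
lemma IsFolded.actsBy {α γ : H.root} (h : IsFolded hθ hst α γ) : ActsBy θ α (-1) := by
  obtain ⟨x, hx, hx0⟩ := exists_ne_zero_mem_rootSp γ
  have hx' := thetaC_mem_rootSp hθ hst hx
  refine actsBy_of_mem (lie_mem_rootSp h hx hx')
    (lie_ne_zero_of_mem_rootSp h hx hx0 hx' (thetaC_ne_zero hθ hx0)) ?_
  rw [thetaC_lie, thetaC_thetaC hθ, neg_one_smul, lie_skew]

lemma IsFolded.thetaRoot_eq {α γ : H.root} (h : IsFolded hθ hst α γ) :
    thetaRoot hθ hst α = α := by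
  apply (rootSystem H).root.injective
  rw [root_thetaRoot, h, map_add, root_thetaRoot, thetaDual_thetaDual hθ, add_comm]

/-- The sign by which `θ` acts is multiplicative along a string of fixed roots. -/
lemma ActsBy.add_nsmul {α β δ : H.root} {n : ℕ} {c d : ℂ}
    (hα : (rootSystem H).root α = (rootSystem H).root β + n • (rootSystem H).root δ)
    (h1 : β ≠ δ) (h2 : β ≠ SymmetricPair.negRoot δ) (hβ : ActsBy θ β c) (hδ : ActsBy θ δ d) :
    ActsBy θ α (d ^ n * c) := by
  obtain ⟨e, he, he0⟩ := exists_ne_zero_mem_rootSp δ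
  obtain ⟨y, hy, hy0⟩ := exists_ne_zero_mem_rootSp β
  refine actsBy_of_mem (toEnd_pow_apply_mem_rootSp hα he hy)
    (toEnd_pow_apply_ne_zero_of_mem_rootSp hα h1 h2 he he0 hy hy0) ?_
  rw [thetaC_toEnd_pow_apply, hδ e he, hβ y hy, map_smul, map_smul, smul_pow, LinearMap.smul_apply,
    smul_smul, mul_comm]

/-- If `β + θ β` is not a root then `θ` acts by the same sign on `g_α` and `g_{α + n β + n θ β}`. -/
lemma ActsBy.add_nsmul_add_nsmul {α α' α'' β : H.root} {n : ℕ} {c : ℂ}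
    (hα' : (rootSystem H).root α' = (rootSystem H).root α + n • (rootSystem H).root β)
    (hα'' : (rootSystem H).root α'' =
      (rootSystem H).root α' + n • (rootSystem H).root (thetaRoot hθ hst β))
    (h1 : α ≠ β) (h2 : α ≠ SymmetricPair.negRoot β) (h3 : α' ≠ thetaRoot hθ hst β)
    (h4 : α' ≠ SymmetricPair.negRoot (thetaRoot hθ hst β))
    (hβ : ∀ x ∈ rootSp β, ⁅x, thetaC θ x⁆ = 0) (hα : ActsBy θ α c) :
    ActsBy θ α'' c := by
  obtain ⟨e, he, he0⟩ := exists_ne_zero_mem_rootSp β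
  obtain ⟨y, hy, hy0⟩ := exists_ne_zero_mem_rootSp α
  have he' := thetaC_mem_rootSp hθ hst he
  have hm := toEnd_pow_apply_mem_rootSp hα' he hy
  have hn := toEnd_pow_apply_ne_zero_of_mem_rootSp hα' h1 h2 he he0 hy hy0
  refine actsBy_of_mem (toEnd_pow_apply_mem_rootSp hα'' he' hm)
    (toEnd_pow_apply_ne_zero_of_mem_rootSp hα'' h3 h4 he' (thetaC_ne_zero hθ he0) hm hn) ?_
  -- `θ` exchanges `ad e` and `ad (θ e)`; as they commute, the vector `(ad θ e)^n (ad e)^n y` only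
  -- picks up the sign of `y`.
  have hcomm : Commute (LieModule.toEnd ℂ (ℂ ⊗[ℝ] g₀) (ℂ ⊗[ℝ] g₀) e)
      (LieModule.toEnd ℂ (ℂ ⊗[ℝ] g₀) (ℂ ⊗[ℝ] g₀) (thetaC θ e)) := by
    refine LinearMap.ext fun z => ?_
    rw [Module.End.mul_apply, Module.End.mul_apply, LieModule.toEnd_apply_apply,
      LieModule.toEnd_apply_apply, LieModule.toEnd_apply_apply, LieModule.toEnd_apply_apply,
      leibniz_lie, hβ e he, zero_lie, zero_add]
  rw [thetaC_toEnd_pow_apply, thetaC_toEnd_pow_apply, thetaC_thetaC hθ, hα y hy, map_smul,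
    map_smul, ← Module.End.mul_apply, (hcomm.pow_pow n n).eq, Module.End.mul_apply]

end SymmetricPair
end

/-! ### Parity of the non-compact length: reduction by reflections -/

noncomputable section

namespace SymmetricPair

variable {g₀ : Type*} [LieRing g₀] [LieAlgebra ℝ g₀] [FiniteDimensional ℝ g₀]
  [LieAlgebra.IsSemisimple ℝ g₀] {θ : g₀ →ₗ⁅ℝ⁆ g₀}
  {H : LieSubalgebra ℂ (ℂ ⊗[ℝ] g₀)} [H.IsCartanSubalgebra]

lemma root_reflectionPerm_eq (α β : H.root) :
    (rootSystem H).root ((rootSystem H).reflectionPerm β α) =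
      (rootSystem H).root α - (rootSystem H).pairingIn ℤ α β • (rootSystem H).root β := by
  rw [RootPairing.root_reflectionPerm, RootPairing.reflection_apply_root' ℤ]

lemma pairingIn_sub_zsmul {α β γ : H.root} {z : ℤ} (δ : H.root)
    (hα : (rootSystem H).root α = (rootSystem H).root β - z • (rootSystem H).root γ) :
    (rootSystem H).pairingIn ℤ α δ =
      (rootSystem H).pairingIn ℤ β δ - z * (rootSystem H).pairingIn ℤ γ δ := by
  apply (algebraMap ℤ ℂ).injective_int
  rw [map_sub, map_mul]
  simp only [RootPairing.algebraMap_pairingIn]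
  have := congrArg (fun φ : Module.Dual ℂ H => φ ((rootSystem H).coroot δ)) hα
  simp only [LinearMap.sub_apply, LinearMap.smul_apply, ← Int.cast_smul_eq_zsmul ℂ,
    smul_eq_mul] at this
  exact this

lemma pairingIn_add {α β γ : H.root} (δ : H.root)
    (hα : (rootSystem H).root α = (rootSystem H).root β + (rootSystem H).root γ) :
    (rootSystem H).pairingIn ℤ α δ =
      (rootSystem H).pairingIn ℤ β δ + (rootSystem H).pairingIn ℤ γ δ := by
  rw [pairingIn_sub_zsmul (α := α) (β := β) (γ := γ) (z := -1) δ
    (by rw [hα, neg_one_zsmul, sub_neg_eq_add])]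
  ring

variable (hθ : IsCartanInvolution θ) (hst : ∀ x ∈ H, thetaC θ x ∈ H)

lemma pairingIn_thetaRoot_right (α β : H.root) :
    (rootSystem H).pairingIn ℤ α (thetaRoot hθ hst β) =
      (rootSystem H).pairingIn ℤ (thetaRoot hθ hst α) β := by
  rw [← pairingIn_thetaRoot hθ hst, thetaRoot_thetaRoot]

section base

variable {b : (rootSystem H).Base}

lemma ne_negRoot_of_isPos {α β : H.root} (hα : b.IsPos α) (hβ : b.IsPos β) : α ≠ negRoot β := by
  rintro rfl
  rw [RootPairing.Base.isPos_iff] at hα hβ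
  rw [height_negRoot] at hα
  lia

variable (hb : ∀ β ∈ b.support, thetaRoot hθ hst β ∈ b.support)

include hb in
/-- A simple root `β ≠ θ β` is either orthogonal to `θ β` or spans with it a system of type `A₂`. -/
lemma pairingIn_thetaRoot_self {β : H.root} (hβ : β ∈ b.support) (hne : thetaRoot hθ hst β ≠ β) :
    (rootSystem H).pairingIn ℤ β (thetaRoot hθ hst β) = 0 ∨
      (rootSystem H).pairingIn ℤ β (thetaRoot hθ hst β) = -1 := by
  have h1 := b.pairingIn_le_zero_of_ne hne.symm hβ (hb β hβ)
  have h2 := (rootSystem H).pairingIn_pairingIn_mem_set_of_isCrystal_of_isRed'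
    (i := β) (j := thetaRoot hθ hst β) (fun h => hne ((rootSystem H).root.injective h).symm)
    (b.root_ne_neg_of_ne hβ (hb β hβ) hne.symm)
  -- Applying `θ` makes the two pairings equal; among the possible pairs for non-proportional roots
  -- this leaves `0`, `1`, `-1`, and distinct simple roots exclude `1`.
  have h3 : (rootSystem H).pairingIn ℤ (thetaRoot hθ hst β) β =
      (rootSystem H).pairingIn ℤ β (thetaRoot hθ hst β) := by
    rw [pairingIn_thetaRoot_right]
  rw [h3] at h2
  simp only [Set.mem_insert_iff, Set.mem_singleton_iff, Prod.mk.injEq] at h2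
  lia

include hb in
/-- If `β` is a simple root which is orthogonal to `θ β` then `[g_β, θ g_β] = 0`. -/
lemma lie_thetaC_eq_zero {β : H.root} (hβ : β ∈ b.support) (hne : thetaRoot hθ hst β ≠ β)
    (h0 : (rootSystem H).pairingIn ℤ β (thetaRoot hθ hst β) = 0) :
    ∀ x ∈ rootSp β, ⁅x, thetaC θ x⁆ = 0 := by
  intro x hx
  by_contra hx0
  have h1 := lie_mem_genWeightSpace_of_mem_genWeightSpace (H := H) (M := ℂ ⊗[ℝ] g₀) hx
    (thetaC_mem_rootSp hθ hst hx)
  have hbot : rootSpace H (β.1 + (thetaRoot hθ hst β).1 : H → ℂ) ≠ ⊥ := by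
    intro hbot
    exact hx0 ((LieSubmodule.mem_bot _).mp (hbot.le h1))
  have hli := b.linearIndependent_pair_of_ne (i := ⟨thetaRoot hθ hst β, hb β hβ⟩) (j := ⟨β, hβ⟩)
    (fun h => hne (congrArg Subtype.val h))
  -- A non-zero bracket would make `β + θ β` a root, but for distinct simple roots the string has
  -- length minus the pairing, here zero.
  have h2 : (rootSystem H).chainTopCoeff (thetaRoot hθ hst β) β =
      -(rootSystem H).pairingIn ℤ β (thetaRoot hθ hst β) :=
    b.chainTopCoeff_eq_of_ne (i := ⟨thetaRoot hθ hst β, hb β hβ⟩) (j := ⟨β, hβ⟩)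
    (fun h => hne (congrArg Subtype.val h))
  have hW : (⟨_, hbot⟩ : LieModule.Weight ℂ H (ℂ ⊗[ℝ] g₀)).IsNonZero := by
    intro hW
    refine b.root_ne_neg_of_ne hβ (hb β hβ) hne.symm ?_
    rw [← sub_eq_zero, sub_neg_eq_add]
    exact DFunLike.coe_injective (F := Module.Dual ℂ H) hW
  have h3 : (rootSystem H).root β + 1 • (rootSystem H).root (thetaRoot hθ hst β) ∈
      Set.range (rootSystem H).root := by
    rw [one_smul]
    refine ⟨⟨⟨_, hbot⟩, by simpa using hW⟩, ?_⟩
    ext y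
    rfl
  rw [RootPairing.root_add_nsmul_mem_range_iff_le_chainTopCoeff hli] at h3
  lia

/-- If `g_β` lay in `p`, then `θ` would map it to itself, forcing `θ β = β`. -/
lemma noncompactLength_eq_zero {β : H.root} (hβ : β ∈ b.support) (hne : thetaRoot hθ hst β ≠ β) :
    noncompactLength θ b β = 0 := by
  rw [noncompactLength_of_mem_support hβ, if_neg]
  intro hp
  obtain ⟨x, hx, hx0⟩ := exists_ne_zero_mem_rootSp β
  have h1 := thetaC_mem_rootSp hθ hst hx
  rw [thetaC_of_mem_p (hp hx)] at h1
  exact hne (eq_of_mem_rootSp (neg_mem_iff.mp h1) hx hx0)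

lemma actsBy_of_mem_support {β : H.root} (hβ : β ∈ b.support) (h : thetaRoot hθ hst β = β) :
    noncompactLength θ b β = 0 ∧ ActsBy θ β 1 ∨ noncompactLength θ b β = 1 ∧ ActsBy θ β (-1) := by
  rw [noncompactLength_of_mem_support hβ]
  split_ifs with hp
  · right
    exact ⟨rfl, fun x hx => by rw [thetaC_of_mem_p (hp hx), neg_one_smul]⟩
  · left
    refine ⟨rfl, (exists_actsBy hθ hst h).resolve_right fun h1 => hp fun x hx => ?_⟩
    rw [mem_p_iff hθ, h1 x hx, neg_one_smul]

/-- The reflections in `β` and `θ β` commute, so their product commutes with `θ` and takes `γ + θ γ`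
to a sum of the same form. -/
lemma exists_isFolded_of_orthogonal {α α' β γ : H.root} {n : ℤ}
    (hr : (rootSystem H).root α = (rootSystem H).root α' + n • (rootSystem H).root β +
      n • (rootSystem H).root (thetaRoot hθ hst β))
    (h0 : (rootSystem H).pairingIn ℤ β (thetaRoot hθ hst β) = 0)
    (hα' : (rootSystem H).pairingIn ℤ α' β = -n) (hγ : IsFolded hθ hst α' γ) :
    ∃ γ', IsFolded hθ hst α γ' := by
  have h1 := pairingIn_add β hγ
  rw [← pairingIn_thetaRoot_right hθ hst γ β] at h1
  have h2 := root_reflectionPerm_eq γ β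
  generalize (rootSystem H).reflectionPerm β γ = γ₁ at h2
  have h3 := pairingIn_sub_zsmul (thetaRoot hθ hst β) h2
  have h4 := root_reflectionPerm_eq γ₁ (thetaRoot hθ hst β)
  refine ⟨(rootSystem H).reflectionPerm (thetaRoot hθ hst β) γ₁, ?_⟩
  have key : ∀ (x x' y y' : Module.Dual ℂ H) (a b : ℤ), n = -(a + b) →
      x + x' + n • y + n • y' = (x - a • y - b • y') + (x' - a • y' - b • y) := by
    rintro x x' y y' a b rfl
    module
  rw [IsFolded, root_thetaRoot, h4, h2, h3, h0, map_sub, map_sub, map_zsmul, map_zsmul,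
    ← root_thetaRoot hθ, ← root_thetaRoot hθ, ← root_thetaRoot hθ, thetaRoot_thetaRoot, hr, hγ,
    mul_zero, sub_zero]
  exact key _ _ _ _ _ _ (by lia)

/-- Here `s_β s_θβ s_β` is the reflection in the fixed root `δ = β + θ β`. It sends `γ` to `γ + n
δ`, and adding the image under `θ` produces the `2 n δ`. -/
lemma exists_isFolded_of_pairing_eq_neg_one {α α' β δ γ : H.root} {n : ℤ}
    (hδ : IsFolded hθ hst δ β)
    (hr : (rootSystem H).root α = (rootSystem H).root α' + (2 * n) • (rootSystem H).root δ)
    (h0 : (rootSystem H).pairingIn ℤ β (thetaRoot hθ hst β) = -1)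
    (hα' : (rootSystem H).pairingIn ℤ α' β = -n) (hγ : IsFolded hθ hst α' γ) :
    ∃ γ', IsFolded hθ hst α γ' := by
  have h0' : (rootSystem H).pairingIn ℤ (thetaRoot hθ hst β) β = -1 := by
    rw [← pairingIn_thetaRoot_right hθ hst, ← h0]
  have hββ : (rootSystem H).pairingIn ℤ β β = 2 := (rootSystem H).pairingIn_same ℤ β
  have h1 := pairingIn_add β hγ
  rw [← pairingIn_thetaRoot_right hθ hst γ β] at h1
  have h2 := root_reflectionPerm_eq γ β
  generalize (rootSystem H).reflectionPerm β γ = γ₁ at h2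
  have h3 := pairingIn_sub_zsmul (thetaRoot hθ hst β) h2
  have h3' := pairingIn_sub_zsmul β h2
  have h4 := root_reflectionPerm_eq γ₁ (thetaRoot hθ hst β)
  generalize (rootSystem H).reflectionPerm (thetaRoot hθ hst β) γ₁ = γ₂ at h4
  have h5 := pairingIn_sub_zsmul β h4
  have h6 := root_reflectionPerm_eq γ₂ β
  generalize (rootSystem H).reflectionPerm β γ₂ = γ₃ at h6
  rw [h0] at h3
  rw [hββ] at h3'
  rw [h0'] at h5
  have key : ∀ (x y y' : Module.Dual ℂ H) (a b c : ℤ), b = -n → a + c = -n →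
      x - a • y - b • y' - c • y = x + n • (y + y') := by
    rintro x y y' a b c rfl h
    obtain rfl : a = -n - c := by lia
    module
  have h7 : (rootSystem H).root γ₃ = (rootSystem H).root γ + n • (rootSystem H).root δ := by
    rw [h6, h4, h2, hδ]
    exact key _ _ _ _ _ _ (by lia) (by lia)
  have key' : ∀ x x' z : Module.Dual ℂ H, x + x' + (2 * n) • z = (x + n • z) + (x' + n • z) := by
    intro x x' z
    module
  refine ⟨γ₃, ?_⟩
  rw [IsFolded, root_thetaRoot, h7, map_add, map_zsmul, ← root_thetaRoot hθ, ← root_thetaRoot hθ,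
    IsFolded.thetaRoot_eq hθ hst hδ, hr, hγ]
  exact key' _ _ _

/-- `α'` is a smaller positive fixed root, not of the form `γ + θ γ`, whose sign determines that
of `α`. -/
structure IsReduction (b : (rootSystem H).Base) (α α' : H.root) : Prop where
  isPos : b.IsPos α'
  fixed : thetaRoot hθ hst α' = α'
  not_isFolded : ∀ γ, ¬ IsFolded hθ hst α' γ
  height_lt : b.height α' < b.height α
  actsBy : ActsBy θ α' ((-1 : ℂ) ^ noncompactLength θ b α') →
    ActsBy θ α ((-1 : ℂ) ^ noncompactLength θ b α)

/-- Take `α' = s_β α = α - n β`. The sign at `β` enters `n` times, just as `m_β` does in `m_α`. -/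
lemma exists_isReduction_of_fixed {α β : H.root} (hpos : b.IsPos α)
    (hα : thetaRoot hθ hst α = α) (hnf : ∀ γ, ¬ IsFolded hθ hst α γ) (hβ : β ∈ b.support)
    (hβθ : thetaRoot hθ hst β = β) (hne : α ≠ β)
    (hn : 0 < (rootSystem H).pairingIn ℤ α β) : ∃ α', IsReduction hθ hst b α α' := by
  obtain ⟨n, hn'⟩ := Int.eq_ofNat_of_zero_le hn.le
  have hβpos := RootPairing.Base.isPos_of_mem_support hβ
  have hr := root_reflectionPerm_eq α β
  have hpos' := hpos.reflectionPerm hβ hne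
  generalize (rootSystem H).reflectionPerm β α = α' at hr hpos'
  have hpair := pairingIn_sub_zsmul β hr
  have hββ : (rootSystem H).pairingIn ℤ β β = 2 := (rootSystem H).pairingIn_same ℤ β
  have hr' : (rootSystem H).root α = (rootSystem H).root α' + (n : ℤ) • (rootSystem H).root β := by rw [hr, hn', sub_add_cancel]
  rw [hββ] at hpair
  have hfix : thetaRoot hθ hst α' = α' := by
    apply (rootSystem H).root.injective
    rw [root_thetaRoot, hr, map_sub, map_zsmul, ← root_thetaRoot hθ, ← root_thetaRoot hθ, hα, hβθ]
  refine ⟨α', hpos', hfix, fun γ hγ => ?_, ?_, fun hact => ?_⟩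
  · have h1 := pairingIn_add β hγ
    rw [← pairingIn_thetaRoot_right hθ hst γ β, hβθ] at h1
    refine hnf ((rootSystem H).reflectionPerm β γ) ?_
    have h2 := root_reflectionPerm_eq γ β
    rw [IsFolded, root_thetaRoot, h2, map_sub, map_zsmul, ← root_thetaRoot hθ,
      ← root_thetaRoot hθ, hβθ, hr', hγ, show (n : ℤ) = -(2 * (rootSystem H).pairingIn ℤ γ β) by lia]
    module
  · rw [b.height_add_zsmul hr', RootPairing.Base.height_one_of_mem_support hβ, smul_eq_mul]
    lia
  -- The pairing of `α'` with `β` is `-n < 0`, that of `β` with itself is `2`.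
  · have hne1 : α' ≠ β := by
      rintro rfl
      lia
    rw [noncompactLength_add_zsmul hr']
    rw [natCast_zsmul] at hr'
    have key : ∀ d, ActsBy θ β d → ActsBy θ α (d ^ n * (-1 : ℂ) ^ noncompactLength θ b α') :=
      fun d hd => ActsBy.add_nsmul hr' hne1 (ne_negRoot_of_isPos hpos' hβpos) hact hd
    rcases actsBy_of_mem_support hθ hst hβ hβθ with ⟨h0, h1⟩ | ⟨h0, h1⟩
    · simpa [h0] using key _ h1
    · rw [h0, mul_one, zpow_add₀ (by norm_num), zpow_natCast, mul_comm]
      exact key _ h1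

include hb in
-- Take `α' = s_β s_θβ α = α - n β - n θ β`. Neither `β` nor `θ β` contributes to the non-compact
-- length, and the sign is unchanged because `[g_β, θ g_β] = 0`.
lemma exists_isReduction_of_orthogonal {α β : H.root} (hpos : b.IsPos α)
    (hα : thetaRoot hθ hst α = α) (hnf : ∀ γ, ¬ IsFolded hθ hst α γ) (hβ : β ∈ b.support)
    (hβθ : thetaRoot hθ hst β ≠ β) (h0 : (rootSystem H).pairingIn ℤ β (thetaRoot hθ hst β) = 0)
    (hn : 0 < (rootSystem H).pairingIn ℤ α β) : ∃ α', IsReduction hθ hst b α α' := by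
  obtain ⟨n, hn'⟩ := Int.eq_ofNat_of_zero_le hn.le
  have hβpos := RootPairing.Base.isPos_of_mem_support hβ
  have hβpos' := RootPairing.Base.isPos_of_mem_support (hb β hβ)
  have h0' : (rootSystem H).pairingIn ℤ (thetaRoot hθ hst β) β = 0 := by
    rw [← pairingIn_thetaRoot_right hθ hst, ← h0]
  have hβ' := hb β hβ
  have hθβ' := thetaRoot_thetaRoot hθ hst β
  have hlie := lie_thetaC_eq_zero hθ hst hb hβ hβθ h0
  have hm := noncompactLength_eq_zero hθ hst hβ hβθ
  have hm' := noncompactLength_eq_zero hθ hst hβ' (by rw [hθβ']; exact hβθ.symm)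
  have hαβ' : (rootSystem H).pairingIn ℤ α (thetaRoot hθ hst β) = n := by
    rw [pairingIn_thetaRoot_right, hα, ← hn']
  have hne : α ≠ thetaRoot hθ hst β := by
    rintro rfl
    rw [hθβ'] at hα
    exact hβθ hα.symm
  have hββ : (rootSystem H).pairingIn ℤ β β = 2 := (rootSystem H).pairingIn_same ℤ β
  have hβ'β' : (rootSystem H).pairingIn ℤ (thetaRoot hθ hst β) (thetaRoot hθ hst β) = 2 := (rootSystem H).pairingIn_same ℤ _
  have hr1 := root_reflectionPerm_eq α (thetaRoot hθ hst β)
  have hpos1 := hpos.reflectionPerm hβ' hne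
  rw [hαβ'] at hr1
  generalize (rootSystem H).reflectionPerm (thetaRoot hθ hst β) α = μ at hr1 hpos1
  have hμ := pairingIn_sub_zsmul β hr1
  have hμ' := pairingIn_sub_zsmul (thetaRoot hθ hst β) hr1
  have hμβ : μ ≠ β := by
    rintro rfl
    lia
  have hr2 := root_reflectionPerm_eq μ β
  have hpos2 := hpos1.reflectionPerm hβ hμβ
  rw [show (rootSystem H).pairingIn ℤ μ β = n by lia] at hr2
  generalize (rootSystem H).reflectionPerm β μ = α' at hr2 hpos2
  have hα' := pairingIn_sub_zsmul β hr2
  have hs1 : (rootSystem H).root α = (rootSystem H).root μ + (n : ℤ) • (rootSystem H).root (thetaRoot hθ hst β) := by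
    rw [hr1, sub_add_cancel]
  have hs2 : (rootSystem H).root μ = (rootSystem H).root α' + (n : ℤ) • (rootSystem H).root β := by rw [hr2, sub_add_cancel]
  have hfix : thetaRoot hθ hst α' = α' := by
    apply (rootSystem H).root.injective
    rw [root_thetaRoot, hr2, hr1, map_sub, map_sub, map_zsmul, map_zsmul, ← root_thetaRoot hθ,
      ← root_thetaRoot hθ, ← root_thetaRoot hθ, hα, hθβ']
    abel
  refine ⟨α', hpos2, hfix, fun γ hγ => ?_, ?_, fun hact => ?_⟩
  · obtain ⟨γ', hγ'⟩ := exists_isFolded_of_orthogonal hθ hst (n := n) (by rw [hs1, hs2]) h0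
      (by lia) hγ
    exact hnf γ' hγ'
  · rw [b.height_add_zsmul hs1, b.height_add_zsmul hs2,
      RootPairing.Base.height_one_of_mem_support hβ,
      RootPairing.Base.height_one_of_mem_support hβ', smul_eq_mul]
    lia
  · rw [noncompactLength_add_zsmul hs1, noncompactLength_add_zsmul hs2, hm, hm', mul_zero,
      add_zero, add_zero]
    rw [natCast_zsmul] at hs1 hs2
    refine ActsBy.add_nsmul_add_nsmul hθ hst hs2 hs1 ?_ (ne_negRoot_of_isPos hpos2 hβpos) ?_
      (ne_negRoot_of_isPos hpos1 hβpos') hlie hact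
    · rintro rfl
      lia
    · rintro rfl
      lia

set_option maxHeartbeats 1000000 in
include hb in
-- Take `α' = α - 2 n δ` with `δ = β + θ β`. Although `θ` is `-1` on `g_δ`, the multiple is even, so
-- neither the sign nor the parity changes. The reflection in `δ` is done as three simple ones,
-- which keep positivity visible.
lemma exists_isReduction_of_pairing_eq_neg_one {α β : H.root} (hpos : b.IsPos α)
    (hα : thetaRoot hθ hst α = α) (hnf : ∀ γ, ¬ IsFolded hθ hst α γ) (hβ : β ∈ b.support)
    (hβθ : thetaRoot hθ hst β ≠ β) (h0 : (rootSystem H).pairingIn ℤ β (thetaRoot hθ hst β) = -1)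
    (hn : 0 < (rootSystem H).pairingIn ℤ α β) : ∃ α', IsReduction hθ hst b α α' := by
  obtain ⟨n, hn'⟩ := Int.eq_ofNat_of_zero_le hn.le
  have hβpos := RootPairing.Base.isPos_of_mem_support hβ
  have hβpos' := RootPairing.Base.isPos_of_mem_support (hb β hβ)
  have h0' : (rootSystem H).pairingIn ℤ (thetaRoot hθ hst β) β = -1 := by
    rw [← pairingIn_thetaRoot_right hθ hst, ← h0]
  have hβ' := hb β hβ
  have hθβ' := thetaRoot_thetaRoot hθ hst β
  have hββ : (rootSystem H).pairingIn ℤ β β = 2 := (rootSystem H).pairingIn_same ℤ β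
  have hβ'β' : (rootSystem H).pairingIn ℤ (thetaRoot hθ hst β) (thetaRoot hθ hst β) = 2 := (rootSystem H).pairingIn_same ℤ _
  obtain ⟨δ, hδ⟩ : ∃ δ, (rootSystem H).root δ = (rootSystem H).root β + (rootSystem H).root (thetaRoot hθ hst β) := by
    refine ⟨(rootSystem H).reflectionPerm (thetaRoot hθ hst β) β, ?_⟩
    rw [root_reflectionPerm_eq, h0, neg_one_zsmul, sub_neg_eq_add]
  have hδpos : b.IsPos δ := hβpos.add hβpos' hδ
  have hδβ := pairingIn_add β hδ
  have hαβ' : (rootSystem H).pairingIn ℤ α (thetaRoot hθ hst β) = n := by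
    rw [pairingIn_thetaRoot_right, hα, ← hn']
  have hne : α ≠ β := by
    rintro rfl
    exact hβθ hα
  have hr1 := root_reflectionPerm_eq α β
  have hpos1 := hpos.reflectionPerm hβ hne
  rw [hn'] at hr1
  generalize (rootSystem H).reflectionPerm β α = μ at hr1 hpos1
  have hμ := pairingIn_sub_zsmul β hr1
  have hμ' := pairingIn_sub_zsmul (thetaRoot hθ hst β) hr1
  -- Equality would force `n = 1` and `α = β + θ β`, which is excluded as folded.
  have hμβ : μ ≠ thetaRoot hθ hst β := by
    rintro rfl
    have h1 : (n : ℤ) = 1 := by lia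
    refine hnf β (?_ : (rootSystem H).root α = (rootSystem H).root β + (rootSystem H).root (thetaRoot hθ hst β))
    rw [hr1, h1]
    module
  have hr2 := root_reflectionPerm_eq μ (thetaRoot hθ hst β)
  have hpos2 := hpos1.reflectionPerm hβ' hμβ
  rw [show (rootSystem H).pairingIn ℤ μ (thetaRoot hθ hst β) = 2 * n by lia] at hr2
  generalize (rootSystem H).reflectionPerm (thetaRoot hθ hst β) μ = ν at hr2 hpos2
  have hν := pairingIn_sub_zsmul β hr2
  have hν' := pairingIn_sub_zsmul (thetaRoot hθ hst β) hr2
  have hνβ : ν ≠ β := by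
    rintro rfl
    lia
  have hr3 := root_reflectionPerm_eq ν β
  have hpos3 := hpos2.reflectionPerm hβ hνβ
  rw [show (rootSystem H).pairingIn ℤ ν β = n by lia] at hr3
  generalize (rootSystem H).reflectionPerm β ν = α' at hr3 hpos3
  have hα' := pairingIn_sub_zsmul β hr3
  have hr' : (rootSystem H).root α = (rootSystem H).root α' + ((2 * n : ℕ) : ℤ) • (rootSystem H).root δ := by
    have key : ∀ x y y' : Module.Dual ℂ H, x = x - (n : ℤ) • y - (2 * n : ℤ) • y' - (n : ℤ) • y +
        (2 * n : ℤ) • (y + y') := by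
      intro x y y'
      module
    rw [hr3, hr2, hr1, hδ, Nat.cast_mul, Nat.cast_ofNat]
    exact key _ _ _
  have hδfix : thetaRoot hθ hst δ = δ := IsFolded.thetaRoot_eq hθ hst hδ
  have hfix : thetaRoot hθ hst α' = α' := by
    have h1 := congrArg (thetaDual hst) hr'
    rw [map_add, map_zsmul, ← root_thetaRoot hθ, ← root_thetaRoot hθ, ← root_thetaRoot hθ, hα,
      hδfix, hr'] at h1
    exact ((rootSystem H).root.injective (add_right_cancel h1)).symm
  refine ⟨α', hpos3, hfix, fun γ hγ => ?_, ?_, fun hact => ?_⟩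
  · obtain ⟨γ', hγ'⟩ := exists_isFolded_of_pairing_eq_neg_one hθ hst (n := n) hδ
      (by rw [hr', Nat.cast_mul, Nat.cast_ofNat]) h0 (by lia) hγ
    exact hnf γ' hγ'
  · rw [b.height_add_zsmul hr', smul_eq_mul]
    have := (b.isPos_iff).mp hδpos
    have h2 : 0 < ((2 * n : ℕ) : ℤ) * b.height δ := mul_pos (by lia) this
    lia
  · rw [noncompactLength_add_zsmul hr', zpow_add₀ (by norm_num), zpow_mul, zpow_natCast, pow_mul,
      neg_one_sq, one_pow, one_zpow, mul_one]
    rw [natCast_zsmul] at hr'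
    have h1 := ActsBy.add_nsmul hr' (by rintro rfl; lia) (ne_negRoot_of_isPos hpos3 hδpos) hact
      (IsFolded.actsBy hθ hst hδ)
    rwa [pow_mul, neg_one_sq, one_pow, one_mul] at h1

include hb in
/-- The sign by which `θ` acts on the root space of a positive fixed root which is not of the
form `γ + θ γ` is given by the parity of the non-compact length. -/
theorem actsBy_of_not_isFolded {α : H.root} (hpos : b.IsPos α) (hα : thetaRoot hθ hst α = α)
    (hnf : ∀ γ, ¬ IsFolded hθ hst α γ) : ActsBy θ α ((-1 : ℂ) ^ noncompactLength θ b α) := by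
  induction hN : (b.height α).toNat using Nat.strong_induction_on generalizing α with
  | _ N ih =>
    suffices h : α ∈ b.support ∨ ∃ α', IsReduction hθ hst b α α' by
      rcases h with h | ⟨α', h⟩
      · rcases actsBy_of_mem_support hθ hst h hα with ⟨h0, h1⟩ | ⟨h0, h1⟩ <;> simpa [h0] using h1
      · refine h.actsBy (ih _ ?_ h.isPos h.fixed h.not_isFolded rfl)
        have h1 := (b.isPos_iff).mp h.isPos
        have h2 := h.height_lt
        lia
    -- This positive pairing is what makes the reflected root strictly lower.
    obtain ⟨β, hβ, hn⟩ := hpos.exists_mem_support_pos_pairingIn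
    rw [RootPairing.zero_lt_pairingIn_iff'] at hn
    by_cases hβθ : thetaRoot hθ hst β = β
    · by_cases hne : α = β
      · exact Or.inl (hne ▸ hβ)
      · exact Or.inr (exists_isReduction_of_fixed hθ hst hpos hα hnf hβ hβθ hne hn)
    · rcases pairingIn_thetaRoot_self hθ hst hb hβ hβθ with h0 | h0
      · exact Or.inr (exists_isReduction_of_orthogonal hθ hst hb hpos hα hnf hβ hβθ h0 hn)
      · exact Or.inr (exists_isReduction_of_pairing_eq_neg_one hθ hst hb hpos hα hnf hβ hβθ h0 hn)

end base

end SymmetricPair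
end

/-! ### Weights, and the index sets in terms of signs -/

noncomputable section

namespace SymmetricPair

variable {g₀ : Type*} [LieRing g₀] [LieAlgebra ℝ g₀] [FiniteDimensional ℝ g₀]
  [LieAlgebra.IsSemisimple ℝ g₀] {θ : g₀ →ₗ⁅ℝ⁆ g₀}
  {H : LieSubalgebra ℂ (ℂ ⊗[ℝ] g₀)} [H.IsCartanSubalgebra]
  {h : ℂ ⊗[ℝ] g₀}

lemma omega_negRoot (hh : h ∈ H) (α : H.root) : omega hh (negRoot α) = -omega hh α := rfl

lemma omega_thetaRoot (hθ : IsCartanInvolution θ) (hst : ∀ x ∈ H, thetaC θ x ∈ H) (hh : h ∈ H)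
    (hθh : thetaC θ h = h) (α : H.root) : omega hh (thetaRoot hθ hst α) = omega hh α :=
  congrArg ((rootSystem H).root α) (Subtype.ext hθh)

lemma omega_add (hh : h ∈ H) {α β γ : H.root}
    (hα : (rootSystem H).root α = (rootSystem H).root β + (rootSystem H).root γ) :
    omega hh α = omega hh β + omega hh γ :=
  congrArg (fun φ : Module.Dual ℂ H => φ ⟨h, hh⟩) hα

lemma omega_nonneg (hh : h ∈ H) {b : (rootSystem H).Base}
    (hdom : ∀ β ∈ b.support, 0 ≤ omega hh β) {α : H.root} (hα : b.IsPos α) : 0 ≤ omega hh α :=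
  RootPairing.Base.IsPos.induction_on_add hα (p := fun α => 0 ≤ omega hh α) hdom
    fun i j l hl hi hj => by rw [omega_add hh hl]; exact add_nonneg hi (hdom j hj)

/-- By dominance negative roots have weight at most zero. Hence the positivity conditions in the
index sets are automatic for `j > 0`. -/
lemma isPos_of_omega_eq (hh : h ∈ H) {b : (rootSystem H).Base}
    (hdom : ∀ β ∈ b.support, 0 ≤ omega hh β) {α : H.root} {j : ℤ} (hj : 0 < j)
    (hα : omega hh α = j) : b.IsPos α := by
  refine (isPos_or_isPos_negRoot b α).resolve_right fun hneg => ?_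
  have h1 := omega_nonneg hh hdom hneg
  rw [omega_negRoot, hα, neg_nonneg] at h1
  have h2 : (0 : ℂ) < (j : ℂ) := by exact_mod_cast hj
  exact absurd h1 (not_le_of_gt h2)

section signs

variable (hθ : IsCartanInvolution θ) (hst : ∀ x ∈ H, thetaC θ x ∈ H) {b : (rootSystem H).Base}
  (hb : ∀ β ∈ b.support, thetaRoot hθ hst β ∈ b.support)

lemma not_actsBy_one_of_neg_one {α : H.root} (hα : ActsBy θ α (-1)) : ¬ ActsBy θ α 1 :=
  fun h1 => by have := h1.unique hα; norm_num at this

include hb in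
-- Folded roots have sign `-1` whatever their length; for the others the parity decides. Any `γ`
-- with `γ + θ γ` positive is itself positive, having half the height.
lemma actsBy_one_iff {α : H.root} (hpos : b.IsPos α) (hα : thetaRoot hθ hst α = α) :
    ActsBy θ α 1 ↔ Even (noncompactLength θ b α) ∧ ¬ ∃ γ, b.IsPos γ ∧ IsFolded hθ hst α γ := by
  by_cases hf : ∃ γ, IsFolded hθ hst α γ
  · obtain ⟨γ, hγ⟩ := hf
    exact iff_of_false (not_actsBy_one_of_neg_one (IsFolded.actsBy hθ hst hγ))
      fun h1 => h1.2 ⟨γ, IsFolded.isPos hθ hst hb hγ hpos, hγ⟩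
  · have h1 := actsBy_of_not_isFolded hθ hst hb hpos hα (not_exists.mp hf)
    rw [and_iff_left fun ⟨γ, hγ⟩ => hf ⟨γ, hγ.2⟩]
    rcases Int.even_or_odd (noncompactLength θ b α) with h2 | h2
    · rw [h2.neg_one_zpow] at h1
      exact iff_of_true h1 h2
    · rw [h2.neg_one_zpow] at h1
      exact iff_of_false (not_actsBy_one_of_neg_one h1) (Int.not_even_iff_odd.mpr h2)

include hb in
lemma actsBy_neg_one_iff {α : H.root} (hpos : b.IsPos α) (hα : thetaRoot hθ hst α = α) :
    ActsBy θ α (-1) ↔ Odd (noncompactLength θ b α) ∨ ∃ γ, b.IsPos γ ∧ IsFolded hθ hst α γ := by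
  have h1 : ActsBy θ α (-1) ↔ ¬ ActsBy θ α 1 :=
    ⟨not_actsBy_one_of_neg_one, (exists_actsBy hθ hst hα).resolve_left⟩
  rw [h1, actsBy_one_iff hθ hst hb hpos hα, not_and_or, not_not, Int.not_even_iff_odd]

variable (hh : h ∈ H)

include hb in
lemma mem_Mk_iff {α : H.root} {j : ℤ} : α ∈ Mk hθ hst hh b j ↔
    b.IsPos α ∧ omega hh α = j ∧ thetaRoot hθ hst α = α ∧ ActsBy θ α 1 := by
  refine and_congr_right fun hpos => and_congr_right fun _ => and_congr_right fun hα => ?_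
  rw [actsBy_one_iff hθ hst hb hpos hα]

include hb in
lemma mem_Mp_iff (hθh : thetaC θ h = h) {α : H.root} {j : ℤ} : α ∈ Mp hθ hst hh b j ↔
    b.IsPos α ∧ omega hh α = j ∧ thetaRoot hθ hst α = α ∧ ActsBy θ α (-1) := by
  constructor
  · rintro (⟨hpos, hω, hα, hm⟩ | ⟨hpos, γ, hγpos, hγ, hω⟩)
    · exact ⟨hpos, hω, hα, (actsBy_neg_one_iff hθ hst hb hpos hα).mpr (Or.inl hm)⟩
    · refine ⟨hpos, ?_, IsFolded.thetaRoot_eq hθ hst hγ, IsFolded.actsBy hθ hst hγ⟩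
      rw [omega_add hh hγ, omega_thetaRoot hθ hst hh hθh, ← two_mul, hω]
  · rintro ⟨hpos, hω, hα, hact⟩
    rcases (actsBy_neg_one_iff hθ hst hb hpos hα).mp hact with hm | ⟨γ, hγpos, hγ⟩
    · exact Or.inl ⟨hpos, hω, hα, hm⟩
    · refine Or.inr ⟨hpos, γ, hγpos, hγ, ?_⟩
      rw [← hω, omega_add hh hγ, omega_thetaRoot hθ hst hh hθh, two_mul]

/-- Passing from positive roots of weight zero to all roots of weight zero. -/
lemma mem_pmRoots_iff {M : Set H.root} {c : ℂ} (hM : ∀ α, α ∈ M ↔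
    b.IsPos α ∧ omega hh α = (0 : ℤ) ∧ thetaRoot hθ hst α = α ∧ ActsBy θ α c) {α : H.root} :
    α ∈ pmRoots M ↔ omega hh α = (0 : ℤ) ∧ thetaRoot hθ hst α = α ∧ ActsBy θ α c := by
  have hneg : ∀ {β : H.root}, omega hh β = (0 : ℤ) ∧ thetaRoot hθ hst β = β ∧ ActsBy θ β c →
      omega hh (negRoot β) = (0 : ℤ) ∧ thetaRoot hθ hst (negRoot β) = negRoot β ∧
        ActsBy θ (negRoot β) c := by
    rintro β ⟨h1, h2, h3⟩
    exact ⟨by rw [omega_negRoot, h1]; simp, by rw [thetaRoot_negRoot, h2],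
      ActsBy.negRoot hθ hst h2 h3⟩
  constructor
  · rintro (hα | ⟨β, hβ, rfl⟩)
    · exact ((hM α).mp hα).2
    · exact hneg ((hM β).mp hβ).2
  · intro hα
    rcases isPos_or_isPos_negRoot b α with hpos | hpos
    · exact Or.inl ((hM α).mpr ⟨hpos, hα⟩)
    · exact Or.inr ⟨negRoot α, (hM _).mpr ⟨hpos, hneg hα⟩, negRoot_negRoot α⟩

lemma mem_pmPairs_iff {q : Sym2 H.root} : q ∈ pmPairs (Cpairs hθ hst hh b 0) ↔
    ∃ α, q = s(α, thetaRoot hθ hst α) ∧ thetaRoot hθ hst α ≠ α ∧ omega hh α = (0 : ℤ) := by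
  constructor
  · rintro (⟨α, hq, -, h1, h2⟩ | ⟨-, ⟨α, rfl, -, h1, h2⟩, rfl⟩)
    · exact ⟨α, hq, h1, h2⟩
    · refine ⟨negRoot α, rfl, ?_, by rw [omega_negRoot, h2]; simp⟩
      rw [thetaRoot_negRoot]
      exact fun h3 => h1 (negRoot_injective h3)
  · rintro ⟨α, rfl, h1, h2⟩
    rcases isPos_or_isPos_negRoot b α with hpos | hpos
    · exact Or.inl ⟨α, rfl, hpos, h1, h2⟩
    · refine Or.inr ⟨_, ⟨negRoot α, rfl, hpos, ?_, by rw [omega_negRoot, h2]; simp⟩, ?_⟩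
      · rw [thetaRoot_negRoot]
        exact fun h3 => h1 (negRoot_injective h3)
      · rw [Sym2.map_mk, thetaRoot_negRoot, negRoot_negRoot, negRoot_negRoot]

end signs

/-! ### The decomposition of an eigenspace of `ad h` and `θ` -/

section decomposition

lemma rootSpace_le_grade (hh : h ∈ H) (χ : H → ℂ) :
    (rootSpace H χ).toSubmodule ≤ Module.End.eigenspace (ad ℂ (ℂ ⊗[ℝ] g₀) h) (χ ⟨h, hh⟩) := by
  intro x hx
  rw [Module.End.mem_eigenspace_iff]
  exact lie_eq_smul_of_mem_rootSpace hx ⟨h, hh⟩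

/-- Root spaces grouped by their value at `h` lie in the eigenspaces of `ad h` and jointly span `g`.
As eigenspaces are independent, each inclusion is an equality. -/
lemma grade_eq_iSup (hh : h ∈ H) (j : ℤ) :
    grade h j = ⨆ χ : H → ℂ, ⨆ (_ : χ ⟨h, hh⟩ = j), (rootSpace H χ).toSubmodule := by
  have h1 : (fun c => ⨆ χ : H → ℂ, ⨆ (_ : χ ⟨h, hh⟩ = c), (rootSpace H χ).toSubmodule) ≤
      (ad ℂ (ℂ ⊗[ℝ] g₀) h).eigenspace := by
    intro c
    refine iSup₂_le ?_
    rintro χ rfl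
    exact rootSpace_le_grade hh χ
  have h2 : ⨆ c, ⨆ χ : H → ℂ, ⨆ (_ : χ ⟨h, hh⟩ = c), (rootSpace H χ).toSubmodule = ⊤ := by
    have h3 := LieModule.iSup_genWeightSpace_eq_top ℂ H (ℂ ⊗[ℝ] g₀)
    rw [← LieSubmodule.toSubmodule_inj, LieSubmodule.iSup_toSubmodule,
      LieSubmodule.top_toSubmodule] at h3
    rw [eq_top_iff, ← h3]
    refine iSup_le fun χ => ?_
    exact le_iSup_of_le (χ ⟨h, hh⟩) (le_iSup₂_of_le χ rfl le_rfl)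
  have h4 := ((Module.End.eigenspaces_iSupIndep _).le_iff_eq_of_iSup_eq_top h2).mp h1
  exact (congrFun h4 j).symm

lemma rootSp_le_grade (hh : h ∈ H) {α : H.root} {j : ℤ} (hα : omega hh α = j) :
    rootSp α ≤ grade h j := by
  rw [grade, ← hα]
  exact rootSpace_le_grade hh _

variable (hθ : IsCartanInvolution θ) (hst : ∀ x ∈ H, thetaC θ x ∈ H)

lemma eq_pair_of_mem {α β : H.root} (hα : α ∈ s(β, thetaRoot hθ hst β)) :
    s(β, thetaRoot hθ hst β) = s(α, thetaRoot hθ hst α) := by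
  rcases Sym2.mem_iff.mp hα with rfl | rfl
  · rfl
  · rw [thetaRoot_thetaRoot, Sym2.eq_swap]

/-- The root space decomposition of the part of the `j`-eigenspace of `ad h` on which `θ` acts as
the sign `ε`. -/
theorem isInternalSum_summandsWith (hh : h ∈ H) (hθh : thetaC θ h = h) {ε : ℂ}
    (hε : ε = 1 ∨ ε = -1) {V : Submodule ℂ (ℂ ⊗[ℝ] g₀)}
    (hV : ∀ x, x ∈ V ↔ thetaC θ x = ε • x) {j : ℤ} {s : Submodule ℂ (ℂ ⊗[ℝ] g₀)}
    (hsH : s ≤ H.toSubmodule) (hsV : s ≤ grade h j ⊓ V)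
    (hs : j = 0 → ∀ x ∈ H, x + ε • thetaC θ x ∈ s) {M : Set H.root}
    (hM : ∀ α, α ∈ M ↔ omega hh α = j ∧ thetaRoot hθ hst α = α ∧ ActsBy θ α ε)
    {C : Set (Sym2 H.root)} (hC : ∀ q, q ∈ C ↔
      ∃ α, q = s(α, thetaRoot hθ hst α) ∧ thetaRoot hθ hst α ≠ α ∧ omega hh α = j)
    {X : H.root → ℂ ⊗[ℝ] g₀} (hX : ∀ α, X α ∈ rootSp α ∧ X α ≠ 0)
    {rep : Sym2 H.root → H.root} (hrep : ∀ q, rep q ∈ q) {v : Sym2 H.root → ℂ ⊗[ℝ] g₀}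
    (hv : ∀ q, v q = X (rep q) + ε • thetaC θ (X (rep q))) :
    IsInternalSum (grade h j ⊓ V) (summandsWith s M C v) := by
  have hε2 : ε * ε = 1 := by rcases hε with rfl | rfl <;> norm_num
  have hθε : ∀ x, thetaC θ (x + ε • thetaC θ x) = ε • (x + ε • thetaC θ x) := by
    intro x
    rw [map_add, map_smul, thetaC_thetaC hθ, smul_add, smul_smul, hε2, one_smul, add_comm]
  have hsub : ∀ i, summandsWith s M C v i ≤ ⨆ j, summandsWith s M C v j := le_iSup _
  constructor
  · have hind := LieModule.iSupIndep_genWeightSpace ℂ H (ℂ ⊗[ℝ] g₀)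
    rw [← LieSubmodule.iSupIndep_toSubmodule] at hind
    -- Each summand is labelled by the weights it involves: `{0}` for `s`, `{α}` for a fixed root,
    -- `{α, θ α}` for a pair. These sets are pairwise disjoint.
    refine hind.of_le_biSup (w := fun i => i.elim {0} (Sum.elim
      (fun α => {((α : H.root).1 : H → ℂ)})
      (fun q => (fun α : H.root => (α.1 : H → ℂ)) '' {α | α ∈ (q : Sym2 H.root)}))) ?_ ?_
    · have hinj : ∀ {α β : H.root}, (α.1 : H → ℂ) = β.1 → α = β := fun hαβ =>
        Subtype.ext (DFunLike.coe_injective hαβ)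
      have hne : ∀ α : H.root, (α.1 : H → ℂ) ≠ 0 := fun α => isNonZero_of_root α
      have hfix : ∀ (α : M) (q : C) (β : H.root), β ∈ (q : Sym2 H.root) → (α : H.root) ≠ β := by
        rintro ⟨α, hα⟩ ⟨q, hq⟩ β hβ rfl
        obtain ⟨γ, rfl, hγ, -⟩ := (hC q).mp hq
        have h1 := ((hM α).mp hα).2.1
        rcases Sym2.mem_iff.mp hβ with h2 | h2
        · exact hγ (by rw [← h2]; exact h1)
        · replace h2 : α = thetaRoot hθ hst γ := h2
          rw [h2, thetaRoot_thetaRoot] at h1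
          exact hγ h1.symm
      rintro (_ | α | q) (_ | β | r) x hx hx'
      · rfl
      · exact absurd (hx'.symm.trans hx) (hne _)
      · obtain ⟨γ, -, rfl⟩ := hx'
        exact absurd hx (hne _)
      · exact absurd (hx.symm.trans hx') (hne _)
      · exact congrArg (fun α => some (Sum.inl α)) (Subtype.ext (hinj (hx.symm.trans hx')))
      · obtain ⟨γ, hγ, rfl⟩ := hx'
        exact absurd (hinj hx).symm (hfix α r γ hγ)
      · obtain ⟨γ, hγ, rfl⟩ := hx
        exact absurd hx' (hne _)
      · obtain ⟨γ, hγ, rfl⟩ := hx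
        exact absurd (hinj hx').symm (hfix β q γ hγ)
      · obtain ⟨γ, hγ, rfl⟩ := hx
        obtain ⟨γ', hγ', hγγ'⟩ := hx'
        obtain rfl := hinj hγγ'
        obtain ⟨q, hq⟩ := q
        obtain ⟨r, hr⟩ := r
        obtain ⟨α, rfl, -⟩ := (hC q).mp hq
        obtain ⟨β, rfl, -⟩ := (hC r).mp hr
        exact congrArg (fun α => some (Sum.inr α)) (Subtype.ext
          ((eq_pair_of_mem hθ hst hγ).trans (eq_pair_of_mem hθ hst hγ').symm))
    · rintro (_ | α | ⟨q, hq⟩)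
      · refine hsH.trans (le_iSup₂_of_le (0 : H → ℂ) rfl ?_)
        exact toLieSubmodule_le_rootSpace_zero ℂ (ℂ ⊗[ℝ] g₀) H
      · exact le_iSup₂_of_le ((α : H.root).1 : H → ℂ) rfl le_rfl
      · obtain ⟨α, rfl, -⟩ := (hC q).mp hq
        refine (Submodule.span_singleton_le_iff_mem _ _).mpr ?_
        have hmem := eq_pair_of_mem hθ hst (hrep s(α, thetaRoot hθ hst α))
        have key : ∀ β : H.root, β ∈ s(α, thetaRoot hθ hst α) → rootSp β ≤
            ⨆ x ∈ (fun α : H.root => (α.1 : H → ℂ)) '' {β | β ∈ s(α, thetaRoot hθ hst α)},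
              (rootSpace H x).toSubmodule := fun β hβ =>
          le_iSup₂_of_le (β.1 : H → ℂ) ⟨β, hβ, rfl⟩ le_rfl
        rw [hv]
        refine add_mem (key _ (hrep _) (hX _).1) (Submodule.smul_mem _ _
          (key _ ?_ (thetaC_mem_rootSp hθ hst (hX _).1)))
        exact (congrArg (_ ∈ ·) hmem).mpr (Sym2.mem_mk_right (rep s(α, thetaRoot hθ hst α)) _)
  · apply le_antisymm
    · refine iSup_le ?_
      rintro (_ | ⟨α, hα⟩ | ⟨q, hq⟩)
      · exact hsV
      · obtain ⟨h1, h2, h3⟩ := (hM α).mp hα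
        exact le_inf (rootSp_le_grade hh h1) fun x hx => (hV x).mpr (h3 x hx)
      · refine (Submodule.span_singleton_le_iff_mem _ _).mpr ?_
        obtain ⟨α, rfl, -, h2⟩ := (hC q).mp hq
        have h3 : omega hh (rep s(α, thetaRoot hθ hst α)) = j := by
          rcases Sym2.mem_iff.mp (hrep s(α, thetaRoot hθ hst α)) with h4 | h4
          · rw [h4, h2]
          · rw [h4, omega_thetaRoot hθ hst hh hθh, h2]
        rw [hv]
        refine ⟨add_mem (rootSp_le_grade hh h3 (hX _).1) (Submodule.smul_mem _ _
          (rootSp_le_grade hh ?_ (thetaC_mem_rootSp hθ hst (hX _).1))), (hV _).mpr (hθε _)⟩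
        rw [omega_thetaRoot hθ hst hh hθh, h3]
    -- The doubled projection `x ↦ x + ε θ x` takes each root space into the sum; on an element of
    -- `V` it is multiplication by `2`, which gives the inclusion.
    · have hP : ∀ χ : H → ℂ, χ ⟨h, hh⟩ = j → ∀ x ∈ rootSpace H χ,
          x + ε • thetaC θ x ∈ ⨆ i, summandsWith s M C v i := by
        intro χ hχ x hx
        by_cases hx0 : x = 0
        · rw [hx0, map_zero, smul_zero, add_zero]
          exact zero_mem _
        by_cases hχ0 : χ = 0
        · subst hχ0
          refine hsub none (hs (Int.cast_eq_zero.mp (hχ.symm : (j : ℂ) = 0)) x ?_)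
          rw [LieAlgebra.rootSpace_zero_eq] at hx
          exact hx
        · obtain ⟨α, rfl⟩ : ∃ α : H.root, (α.1 : H → ℂ) = χ := by
            refine ⟨⟨⟨χ, fun hbot => hx0 ((LieSubmodule.mem_bot _).mp (hbot.le hx))⟩, ?_⟩, rfl⟩
            exact Finset.mem_filter.mpr ⟨Finset.mem_univ _, hχ0⟩
          replace hx : x ∈ rootSp α := hx
          replace hχ : omega hh α = j := hχ
          by_cases hα : thetaRoot hθ hst α = α
          · have hcase : ActsBy θ α ε ∨ ActsBy θ α (-ε) := by
              have := exists_actsBy hθ hst hα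
              rcases hε with rfl | rfl
              · exact this
              · rw [neg_neg]
                exact this.symm
            rcases hcase with h1 | h1
            · refine hsub (some (Sum.inl ⟨α, (hM α).mpr ⟨hχ, hα, h1⟩⟩)) ?_
              rw [h1 x hx]
              exact add_mem hx (Submodule.smul_mem _ _ (Submodule.smul_mem _ _ hx))
            · rw [h1 x hx, smul_smul, mul_neg, hε2, neg_one_smul, add_neg_cancel]
              exact zero_mem _
          · have hq : s(α, thetaRoot hθ hst α) ∈ C := (hC _).mpr ⟨α, rfl, hα, hχ⟩
            refine hsub (some (Sum.inr ⟨_, hq⟩)) (Submodule.mem_span_singleton.mpr ?_)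
            change ∃ d : ℂ, d • v s(α, thetaRoot hθ hst α) = _
            rw [hv]
            rcases Sym2.mem_iff.mp (hrep s(α, thetaRoot hθ hst α)) with h4 | h4
            · rw [h4]
              obtain ⟨d, rfl⟩ := exists_smul_eq_of_mem_rootSpace (H := H) (isNonZero_of_root α)
                (hX α).1 (hX α).2 hx
              exact ⟨d, by rw [smul_add, map_smul, smul_comm]⟩
            · rw [h4]
              obtain ⟨d, hd⟩ := exists_smul_eq_of_mem_rootSpace (H := H) (isNonZero_of_root _)
                (hX (thetaRoot hθ hst α)).1 (hX (thetaRoot hθ hst α)).2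
                (thetaC_mem_rootSp hθ hst hx)
              -- The chosen representative is `θ α`, so `θ x`, not `x`, is `d` times the chosen
              -- vector; exchanging the two terms of `x + ε θ x` costs a factor `ε`.
              refine ⟨ε * d, ?_⟩
              have hx' : x = d • thetaC θ (X (thetaRoot hθ hst α)) := by
                rw [← map_smul, ← hd, thetaC_thetaC hθ]
              rw [hd, hx', smul_add, smul_smul, smul_smul,
                show ε * d * ε = d by rw [mul_right_comm, hε2, one_mul], add_comm]
      rintro x ⟨hx, hxV⟩
      have h1 : x ∈ Submodule.comap (LinearMap.id + ε • thetaC θ)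
          (⨆ i, summandsWith s M C v i) := by
        refine (?_ : grade h j ≤ _) hx
        rw [grade_eq_iSup hh]
        exact iSup₂_le fun χ hχ y hy => hP χ hχ y hy
      have h2 : x + ε • thetaC θ x ∈ ⨆ i, summandsWith s M C v i := h1
      rw [(hV x).mp hxV, smul_smul, hε2, one_smul, ← two_smul ℂ x] at h2
      have h3 := Submodule.smul_mem _ (2⁻¹ : ℂ) h2
      rwa [inv_smul_smul₀ two_ne_zero] at h3

lemma IsInternalSum.of_summandsWith_bot {V : Submodule ℂ (ℂ ⊗[ℝ] g₀)} {M : Set H.root}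
    {C : Set (Sym2 H.root)} {v : Sym2 H.root → ℂ ⊗[ℝ] g₀}
    (hV : IsInternalSum V (summandsWith ⊥ M C v)) : IsInternalSum V (summands M C v) := by
  refine ⟨hV.1.comp (f := some) (Option.some_injective _), ?_⟩
  rw [← hV.2, iSup_option]
  exact (bot_sup_eq _).symm

end decomposition

end SymmetricPair
end

/-! ### The four decompositions -/

open SymmetricPair in
theorem mainTheorem4 {g₀ : Type*} [LieRing g₀] [LieAlgebra ℝ g₀] [FiniteDimensional ℝ g₀]
    [LieAlgebra.IsSemisimple ℝ g₀] (θ : g₀ →ₗ⁅ℝ⁆ g₀) (hθ : IsCartanInvolution θ)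
    (h e f : ℂ ⊗[ℝ] g₀) (hKS : IsKSTriple θ h e f)
    (H : LieSubalgebra ℂ (ℂ ⊗[ℝ] g₀)) [H.IsCartanSubalgebra]
    (t a : Submodule ℂ (ℂ ⊗[ℝ] g₀)) (hH : IsMaximallyCompact θ h H t a)
    (Ψ : (rootSystem H).Base)
    (hΨ_dom : ∀ β ∈ Ψ.support, 0 ≤ omega hH.h_mem_H β)
    (hΨ_stable : ∀ β ∈ Ψ.support, thetaRoot hθ hH.stable β ∈ Ψ.support)
    (X : H.root → ℂ ⊗[ℝ] g₀) (hX : ∀ α, X α ∈ rootSp α ∧ X α ≠ 0)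
    (rep : Sym2 H.root → H.root) (hrep : ∀ q, rep q ∈ q) :
    IsInternalSum (grade h 0 ⊓ k θ)
      (summandsWith t (pmRoots (Mk hθ hH.stable hH.h_mem_H Ψ 0))
        (pmPairs (Cpairs hθ hH.stable hH.h_mem_H Ψ 0))
        (fun q => X (rep q) + thetaC θ (X (rep q)))) ∧
    (∀ j : ℤ, 0 < j → IsInternalSum (grade h j ⊓ k θ)
      (summands (Mk hθ hH.stable hH.h_mem_H Ψ j) (Cpairs hθ hH.stable hH.h_mem_H Ψ j)
        (fun q => X (rep q) + thetaC θ (X (rep q))))) ∧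
    IsInternalSum (grade h 0 ⊓ p θ)
      (summandsWith a (pmRoots (Mp hθ hH.stable hH.h_mem_H Ψ 0))
        (pmPairs (Cpairs hθ hH.stable hH.h_mem_H Ψ 0))
        (fun q => X (rep q) - thetaC θ (X (rep q)))) ∧
    (∀ j : ℤ, 0 < j → IsInternalSum (grade h j ⊓ p θ)
      (summands (Mp hθ hH.stable hH.h_mem_H Ψ j) (Cpairs hθ hH.stable hH.h_mem_H Ψ j)
        (fun q => X (rep q) - thetaC θ (X (rep q))))) := by
  have hh := hH.h_mem_H
  have hst := hH.stable
  have hθh : thetaC θ h = h := thetaC_of_mem_k hKS.h_mem_k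
  have htH : t ≤ H.toSubmodule := hH.sup_eq ▸ le_sup_left
  have haH : a ≤ H.toSubmodule := hH.sup_eq ▸ le_sup_right
  have hH0 : H.toSubmodule ≤ grade h 0 := by
    intro x hx
    have h1 := congrArg Subtype.val (trivial_lie_zero H H ⟨h, hh⟩ ⟨x, hx⟩)
    rw [SymmetricPair.grade, Module.End.mem_eigenspace_iff, Int.cast_zero, zero_smul]
    exact h1
  have hV1 : ∀ x, x ∈ k θ ↔ thetaC θ x = (1 : ℂ) • x := fun x => by
    rw [mem_k_iff hθ, one_smul]
  have hV2 : ∀ x, x ∈ p θ ↔ thetaC θ x = (-1 : ℂ) • x := fun x => by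
    rw [mem_p_iff hθ, neg_one_smul]
  -- Thus on `H` the doubled projections are `2 y` and `2 z`, which accounts for the summands `t`
  -- and `a` in weight zero.
  have hdec : ∀ x ∈ H, ∃ y ∈ t, ∃ z ∈ a, y + z = x ∧ thetaC θ x = y - z := by
    intro x hx
    have hx' : x ∈ t ⊔ a := hH.sup_eq ▸ hx
    obtain ⟨y, hy, z, hz, rfl⟩ := Submodule.mem_sup.mp hx'
    refine ⟨y, hy, z, hz, rfl, ?_⟩
    rw [map_add, thetaC_of_mem_k (hH.t_maximal.prop.1 hy),
      thetaC_of_mem_p (hH.a_maximal.prop.1 hz), sub_eq_add_neg]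
  have hpos : ∀ {j : ℤ}, 0 < j → ∀ {α : H.root}, omega hh α = j → Ψ.IsPos α :=
    fun hj _ hα => isPos_of_omega_eq hh hΨ_dom hj hα
  have hC : ∀ {j : ℤ}, 0 < j → ∀ q, q ∈ Cpairs hθ hst hh Ψ j ↔
      ∃ α, q = s(α, thetaRoot hθ hst α) ∧ thetaRoot hθ hst α ≠ α ∧ omega hh α = j :=
    fun hj q => ⟨fun ⟨α, h1, _, h2⟩ => ⟨α, h1, h2⟩,
      fun ⟨α, h1, h2, h3⟩ => ⟨α, h1, hpos hj h3, h2, h3⟩⟩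
  refine ⟨?_, fun j hj => ?_, ?_, fun j hj => ?_⟩
  · refine isInternalSum_summandsWith hθ hst hh hθh (Or.inl rfl) hV1 htH
      (le_inf (htH.trans hH0) hH.t_maximal.prop.1) (fun _ x hx => ?_)
      (fun α => mem_pmRoots_iff hθ hst hh fun α => mem_Mk_iff hθ hst hΨ_stable hh)
      (fun q => mem_pmPairs_iff hθ hst hh) hX hrep fun q => by rw [one_smul]
    obtain ⟨y, hy, z, hz, rfl, h1⟩ := hdec x hx
    rw [h1, one_smul, add_add_sub_cancel]
    exact add_mem hy hy
  -- In positive weight the Cartan subalgebra contributes nothing, so the extra summand is `⊥`.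
  · refine (isInternalSum_summandsWith hθ hst hh hθh (Or.inl rfl) hV1 bot_le bot_le
      (fun h0 => absurd h0 hj.ne') (fun α => (mem_Mk_iff hθ hst hΨ_stable hh).trans
        (and_iff_right_of_imp fun h1 => hpos hj h1.1)) (hC hj) hX hrep
      fun q => by rw [one_smul]).of_summandsWith_bot
  · refine isInternalSum_summandsWith hθ hst hh hθh (Or.inr rfl) hV2 haH
      (le_inf (haH.trans hH0) hH.a_maximal.prop.1) (fun _ x hx => ?_)
      (fun α => mem_pmRoots_iff hθ hst hh fun α => mem_Mp_iff hθ hst hΨ_stable hh hθh)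
      (fun q => mem_pmPairs_iff hθ hst hh) hX hrep fun q => by rw [neg_one_smul, sub_eq_add_neg]
    obtain ⟨y, hy, z, hz, rfl, h1⟩ := hdec x hx
    rw [h1, neg_one_smul, ← sub_eq_add_neg, add_sub_sub_cancel]
    exact add_mem hz hz
  · refine (isInternalSum_summandsWith hθ hst hh hθh (Or.inr rfl) hV2 bot_le bot_le
      (fun h0 => absurd h0 hj.ne') (fun α => (mem_Mp_iff hθ hst hΨ_stable hh hθh).trans
        (and_iff_right_of_imp fun h1 => hpos hj h1.1)) (hC hj) hX hrep
      fun q => by rw [neg_one_smul, sub_eq_add_neg]).of_summandsWith_bot
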